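/- Let $N\ge 3$ be an integer. For $\rho\in(0,1)$ let $\Omega_\rho=\{x\in\mathbb R^N:\rho<|x|<1\}$, let $G_\rho$ be the Green function of $-\Delta$ on $\Omega_\rho$ with zero Dirichlet boundary condition, let $H_\rho(x,y)=\frac{1}{\omega_{N-1}(N-2)|x-y|^{N-2}}-G_\rho(x,y)$ be its regular part ($\omega_{N-1}$ the surface measure of the unit sphere in $\mathbb R^N$; for fixed $y$, $H_\rho(\cdot,y)$ extends to a function that is harmonic in $\Omega_\rho$ and continuous on $\overline{\Omega_\rho}$), and let $\tau_\rho(x)=H_\rho(x,x)$ be the Robin function. For an integer $k\ge 2$ and $r>0$ put $$\xi_j(r)=\Bigl(r\cos\tfrac{2\pi(j-1)}k,\ r\sin\tfrac{2\pi(j-1)}k,\ 0\Bigr)\in\mathbb R\times\mathbb R\times\mathbb R^{N-2}\quad(1\le j\le k),$$ and, for $\rho<r<1$, $$\Lambda_1(r)=\tau_\rho(\xi_1(r))-\sum_{j=1}^{k-1}G_\rho(\xi_1(r),\xi_{j+1}(r)).$$ Put also $$\mathfrak C_{k,N}=\sum_{j=1}^{k-1}\frac1{(2\sin(\pi j/k))^{N-2}},\qquad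 \mathfrak a_{k,N}=\Bigl(\frac{\mathfrak C_{k,N}}{2k(N-2)^{N-3}}\Bigr)^{\frac{2}{N-2}}.$$ Let $C_m^{\lambda}$ be the Gegenbauer polynomials, $(1-2tx+x^2)^{-\lambda}=\sum_{m\ge0}C_m^\lambda(t)x^m$ (for small $|x|$), let $Z_m(x,y)=\frac{N+2m-2}{N-2}\,C_m^{\frac{N-2}{2}}(x\cdot y)$ for unit vectors $x,y$ (zonal harmonics), and $d_m=\binom{m+N-2}{N-2}+\binom{m+N-3}{N-2}$. (1) For every $k\ge2$ and $\rho\in(0,1)$ the minimum $\mathfrak m(\rho)=\min_{r\in(\rho,1)}\Lambda_1(r)$ is attained, and for every $k\ge2$ there is a unique threshold $\rho_k\in(0,1)$ such that $\mathfrak m(\rho)>0$ for $\rho\in(\rho_k,1)$ and $\mathfrak m(\rho)<0$ for $\rho\in(0,\rho_k)$. It is the unique zero of $\mathfrak m$ in $(0,1)$, and it satisfies $$-\frac{\mathfrak C_{k,N}}{N-2}+\sum_{m=0}^{\infty}\frac1{2m+N-2}\,\frac{2\rho_k^{\frac{2m+N-2}2}}{1+\rho_k^{\frac{2m+N-2}2}}\Bigl(d_m+\sum_{j=1}^{k-1}Z_m(\xi_1(1),\xi_{j+1}(1))\Bigr)=0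 .$$ (2) For every $k\ge 2$ one has $\mathfrak a_{k,N}>0$ and $$\rho_k>\frac{2\mathfrak a_{k,N}+1-\sqrt{4\mathfrak a_{k,N}+1}}{2\mathfrak a_{k,N}} .$$ (3) As $k\to\infty$: $\mathfrak C_{k,N}/k\to+\infty$, $\mathfrak a_{k,N}\to+\infty$, the right-hand side of the inequality in (2) tends to $1$, and $\rho_k\to1$. In particular, for every fixed $\rho\in(0,1)$, $\min_{r\in(\rho,1)}\Lambda_1(r)<0$ for all sufficiently large $k$. (4) $\mathfrak C_{k,N}$ is strictly increasing in $k\ge2$. If $N=4$, then $\mathfrak C_{k,4}=\frac{k^2-1}{12}$ for $k\ge 2$, and $\mathfrak C_{k,4}/k$ is strictly increasing in $k\ge2$. -/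

import Mathlib

noncomputable section

/-- The open annulus `Ω_ρ = {x ∈ ℝ^N : ρ < |x| < 1}`. -/
def annulus (N : ℕ) (ρ : ℝ) : Set (EuclideanSpace ℝ (Fin N)) :=
  {x | ρ < ‖x‖ ∧ ‖x‖ < 1}

/-- `ω_{N-1}`, the surface measure of the unit sphere of `ℝ^N`. -/
def sphereArea (N : ℕ) : ℝ :=
  (MeasureTheory.Measure.toSphere
    (MeasureTheory.volume : MeasureTheory.Measure (EuclideanSpace ℝ (Fin N)))).real Set.univ

/-- The fundamental solution `1 / (ω_{N-1} (N-2) |z|^{N-2})` of `-Δ` in `ℝ^N`, `N ≥ 3`. -/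
def fundamentalSolution (N : ℕ) (z : EuclideanSpace ℝ (Fin N)) : ℝ :=
  1 / (sphereArea N * ((N : ℝ) - 2) * ‖z‖ ^ (N - 2))

/-- `h` solves the Dirichlet problem that characterizes the regular part `H(·, y)` of the Green
function of `-Δ` on `Ω` with pole `y`: it is harmonic in `Ω`, continuous up to the boundary, and
agrees on `∂Ω` with the fundamental solution centred at `y`. Equivalently, the function
`G(·, y) = fundamentalSolution (· - y) - h` satisfies `-Δ G(·, y) = δ_y` in `Ω` and vanishes
on `∂Ω`. By the maximum principle there is at most one such `h` on `closure Ω` when `Ω` is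
bounded. -/
def IsRegularPart {N : ℕ} (Ω : Set (EuclideanSpace ℝ (Fin N))) (y : EuclideanSpace ℝ (Fin N))
    (h : EuclideanSpace ℝ (Fin N) → ℝ) : Prop :=
  InnerProductSpace.HarmonicOnNhd h Ω ∧ ContinuousOn h (closure Ω) ∧
    ∀ x ∈ frontier Ω, h x = fundamentalSolution N (x - y)

/-- The regular part `H(x, y)` of the Green function of `-Δ` on `Ω` (Dirichlet condition). -/
def regularPart {N : ℕ} (Ω : Set (EuclideanSpace ℝ (Fin N)))
    (x y : EuclideanSpace ℝ (Fin N)) : ℝ :=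
  Classical.epsilon (IsRegularPart Ω y) x

/-- The Green function `G(x, y)` of `-Δ` on `Ω` with zero Dirichlet condition, for `x ≠ y`. -/
def greenFunction {N : ℕ} (Ω : Set (EuclideanSpace ℝ (Fin N)))
    (x y : EuclideanSpace ℝ (Fin N)) : ℝ :=
  fundamentalSolution N (x - y) - regularPart Ω x y

/-- The Robin function `τ(x) = H(x, x)` of `Ω`. -/
def robinFunction {N : ℕ} (Ω : Set (EuclideanSpace ℝ (Fin N)))
    (x : EuclideanSpace ℝ (Fin N)) : ℝ :=
  regularPart Ω x x

/-- The point `ξ_j(r) = (r e^{2πi(j-1)/k}, 0) ∈ ℝ² × ℝ^{N-2}`, for `j = 1, …, k`. -/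
def peak (N k j : ℕ) (r : ℝ) : EuclideanSpace ℝ (Fin N) :=
  WithLp.toLp 2 fun i : Fin N =>
    if i.val = 0 then r * Real.cos (2 * Real.pi * ((j : ℝ) - 1) / k)
    else if i.val = 1 then r * Real.sin (2 * Real.pi * ((j : ℝ) - 1) / k)
    else 0

/-- `Λ₁(r) = τ_ρ(ξ_1(r)) - ∑_{j=1}^{k-1} G_ρ(ξ_1(r), ξ_{j+1}(r))` on the annulus `Ω_ρ`. -/
def Lambda1 (N k : ℕ) (ρ r : ℝ) : ℝ :=
  robinFunction (annulus N ρ) (peak N k 1 r) -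
    ∑ j ∈ Finset.Ico 1 k, greenFunction (annulus N ρ) (peak N k 1 r) (peak N k (j + 1) r)

/-- `𝔪(ρ) = min_{r ∈ (ρ, 1)} Λ₁(r)`, written as an infimum (that it is attained is part of the
theorem). -/
def minLambda1 (N k : ℕ) (ρ : ℝ) : ℝ :=
  sInf (Lambda1 N k ρ '' Set.Ioo ρ 1)

/-- `s ∈ (0, 1)` is a threshold: the minimum of `Λ₁` over `(ρ, 1)` is positive for
`ρ ∈ (s, 1)` and negative for `ρ ∈ (0, s)`. -/
def IsThreshold (N k : ℕ) (s : ℝ) : Prop :=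
  s ∈ Set.Ioo (0 : ℝ) 1 ∧
    (∀ ρ ∈ Set.Ioo s 1, 0 < minLambda1 N k ρ) ∧
    (∀ ρ ∈ Set.Ioo 0 s, minLambda1 N k ρ < 0)

/-- `C_{k,N} = ∑_{j=1}^{k-1} (2 sin (π j / k))^{-(N-2)}`. -/
def peakConst (N k : ℕ) : ℝ :=
  ∑ j ∈ Finset.Ico 1 k, 1 / (2 * Real.sin (Real.pi * j / k)) ^ (N - 2)

/-- `a_{k,N} = (C_{k,N} / (2 k (N-2)^{N-3}))^{2/(N-2)}`. -/
def thresholdParam (N k : ℕ) : ℝ :=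
  (peakConst N k / (2 * k * ((N : ℝ) - 2) ^ (N - 3))) ^ (2 / ((N : ℝ) - 2))

/-- `(2a + 1 - √(4a + 1)) / (2a)` with `a = a_{k,N}`. -/
def thresholdBound (N k : ℕ) : ℝ :=
  (2 * thresholdParam N k + 1 - Real.sqrt (4 * thresholdParam N k + 1)) /
    (2 * thresholdParam N k)

/-- The Gegenbauer polynomial `C_m^l(t)`: the coefficient of `x^m` in the expansion of
`(1 - 2 t x + x²)^{-l}` at `x = 0`. -/
def gegenbauer (l : ℝ) (m : ℕ) (t : ℝ) : ℝ :=
  iteratedDeriv m (fun x : ℝ => (1 - 2 * t * x + x ^ 2) ^ (-l)) 0 / (m.factorial : ℝ)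

/-- The zonal harmonic `Z_m(x, y) = ((N + 2m - 2)/(N - 2)) C_m^{(N-2)/2}(x · y)` of degree `m`,
for unit vectors `x`, `y` of `ℝ^N`. -/
def zonalHarmonic {N : ℕ} (m : ℕ) (x y : EuclideanSpace ℝ (Fin N)) : ℝ :=
  (((N : ℝ) + 2 * m - 2) / ((N : ℝ) - 2)) * gegenbauer (((N : ℝ) - 2) / 2) m (inner ℝ x y)

/-- `d_m = binom(m+N-2, N-2) + binom(m+N-3, N-2)`, the dimension of the space of spherical
harmonics of degree `m` (equal to `1` for `m = 0`, `N ≥ 3`). -/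
def harmonicDim (N m : ℕ) : ℕ :=
  (m + N - 2).choose (N - 2) + (m + N - 3).choose (N - 2)

end

/-! Write `n = N - 2`, `q = 2m + n`, and let `ω` be the area of the unit sphere. The method of
images gives the regular part of the annulus as four explicit series of point charges. When both
arguments lie on the sphere of radius `r`, expanding each charge in Gegenbauer polynomials and
summing geometric series over the images turns it into a zonal series with radial factors `R_m(r) =
(r^q + (ρ/r)^q - 2ρ^q) / (1 - ρ^q)`. Summing over the `k` peaks gives `ω n r^n Λ₁(r) + C_k = ∑ c_m
R_m(r)`, where `C_k` is `peakConst` and `c_m` is the sum of `C_m^{n/2}` over the angles `2πj/k`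
(`hasSum_Lambda1`).

Two facts decide the sign of the minimum. First, `c_m ≥ 0` (`orbitCoeff_nonneg`): Gegenbauer
polynomials are cosine sums with positive coefficients, and cosines summed over `k`-th roots of
unity are nonnegative. Second, `r^q (ρ/r)^q = ρ^q` does not depend on `r`, so by AM-GM all the `R_m`
are minimal at the same point `r = √ρ = σ`, with value `2σ^q / (1 + σ^q)` (`le_radialFactor`). Hence
the minimum of `Λ₁` has the sign of `T(σ) - C_k` with `T(σ) = ∑ c_m 2σ^q / (1 + σ^q)`
(`minLambda1_sign`), although the weight `r^n` may move the minimizer away from `√ρ`. The function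
`T` increases strictly from `0` to infinity on `[0, 1)`, so it takes the value `C_k` exactly once;
this is the threshold and its equation.

For the lower bound, `T(σ) < 2 ∑ c_m σ^q ≤ 2k (σ / (1 - σ²))^n`, which at the threshold becomes a
quadratic inequality in `ρ`. Since `C_k / k` dominates a harmonic sum, the bound tends to `1`. In
dimension four, `C_k` comes from Parseval's identity on the cyclic group. -/

open Finset Filter Topology
open scoped Laplacian

/-! ### Gegenbauer polynomials as cosine sums with positive coefficients -/

/-- The function `(1 - 2 t x + x²)^{-l}` for `t = cos θ` is a sum of cosines. -/
noncomputable def gegenbauerCos (l : ℝ) (m : ℕ) (θ : ℝ) : ℝ :=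
  ∑ p ∈ antidiagonal m,
    Ring.multichoose l p.1 * Ring.multichoose l p.2 * Real.cos (((p.1 : ℝ) - p.2) * θ)

theorem multichoose_real_pos {l : ℝ} (hl : 0 < l) (a : ℕ) : 0 < Ring.multichoose l a := by
  have h := Ring.factorial_nsmul_multichoose_eq_ascPochhammer l a
  have h2 : 0 < (ascPochhammer ℝ a).eval l := ascPochhammer_pos a l hl
  rw [← ascPochhammer_map (algebraMap ℕ ℝ), Polynomial.eval_map_algebraMap,
    Polynomial.aeval_eq_smeval, ← h, nsmul_eq_mul] at h2
  exact pos_of_mul_pos_right h2 (by positivity)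

theorem hasSum_multichoose_mul_pow (l : ℝ) {x : ℝ} (hx : |x| < 1) :
    HasSum (fun a : ℕ => Ring.multichoose l a * x ^ a) (1 / (1 - x) ^ l) := by
  have h := (Real.one_div_one_sub_rpow_hasFPowerSeriesOnBall_zero l).hasSum (y := x)
    (by simpa [enorm_eq_nnnorm, Metric.mem_eball, edist_zero_right, ← NNReal.coe_lt_coe] using hx)
  simpa [FormalMultilinearSeries.ofScalars_apply_eq, Ring.multichoose_eq, mul_comm] using h

theorem hasSum_multichoose_mul_cpow (l : ℝ) {w : ℂ} (hw : ‖w‖ < 1) :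
    HasSum (fun a : ℕ => ((Ring.multichoose l a : ℝ) : ℂ) * w ^ a) (1 / (1 - w) ^ (l : ℂ)) := by
  have h := (Complex.one_div_one_sub_cpow_hasFPowerSeriesOnBall_zero l).hasSum (y := w)
    (by simpa [enorm_eq_nnnorm, Metric.mem_eball, edist_zero_right, ← NNReal.coe_lt_coe] using hw)
  have e : ∀ n : ℕ, ((Ring.multichoose l n : ℝ) : ℂ) = Ring.choose ((l : ℂ) + n - 1) n := by
    intro n
    rw [Ring.multichoose_eq, Complex.ofReal_choose]
    push_cast
    rfl
  simpa [FormalMultilinearSeries.ofScalars_apply_eq, e, mul_comm] using h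

theorem summable_norm_multichoose_mul_cpow {l : ℝ} (hl : 0 < l) {w : ℂ} (hw : ‖w‖ < 1) :
    Summable fun a : ℕ => ‖((Ring.multichoose l a : ℝ) : ℂ) * w ^ a‖ := by
  have h := (hasSum_multichoose_mul_pow l (x := ‖w‖) (by simpa using hw)).summable
  refine h.congr fun a => ?_
  simp [abs_of_pos (multichoose_real_pos hl a)]

theorem one_sub_two_mul_cos_add_sq (x θ : ℝ) :
    1 - 2 * Real.cos θ * x + x ^ 2 = ‖1 - Complex.exp (θ * Complex.I) * x‖ ^ 2 := by
  rw [← Complex.normSq_eq_norm_sq, Complex.normSq_apply]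
  simp only [Complex.sub_re, Complex.sub_im, Complex.one_re, Complex.one_im, Complex.re_mul_ofReal,
    Complex.im_mul_ofReal, Complex.exp_ofReal_mul_I_re, Complex.exp_ofReal_mul_I_im]
  nlinarith [Real.sin_sq_add_cos_sq θ]

/-- The base factors as `(1 - w)(1 - w̄)` with `w = e^{iθ} x`. The Cauchy product of the two
binomial series has phases `(p.1 - p.2) θ`, and real parts leave the cosines. -/
theorem hasSum_gegenbauerCos {l : ℝ} (hl : 0 < l) (θ : ℝ) {x : ℝ} (hx : |x| < 1) :
    HasSum (fun m : ℕ => gegenbauerCos l m θ * x ^ m)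
      ((1 - 2 * Real.cos θ * x + x ^ 2) ^ (-l)) := by
  set w : ℂ := Complex.exp (θ * Complex.I) * x with hw
  have hwn : ‖w‖ = |x| := by simp [hw, Complex.norm_exp_ofReal_mul_I]
  have hw1 : ‖w‖ < 1 := by rwa [hwn]
  have hw2 : ‖(starRingEnd ℂ) w‖ < 1 := by simpa using hw1
  have s1 := summable_norm_multichoose_mul_cpow hl hw1
  have s2 := summable_norm_multichoose_mul_cpow hl hw2
  have hs := (summable_norm_sum_mul_antidiagonal_of_summable_norm s1 s2).of_norm.hasSum
  rw [← tsum_mul_tsum_eq_tsum_sum_antidiagonal_of_summable_norm s1 s2,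
    (hasSum_multichoose_mul_cpow l hw1).tsum_eq, (hasSum_multichoose_mul_cpow l hw2).tsum_eq] at hs
  have hre := Complex.hasSum_re hs
  convert hre using 1
  · funext m
    rw [Complex.re_sum, gegenbauerCos, Finset.sum_mul]
    refine Finset.sum_congr rfl fun p hp => ?_
    have hp' : p.1 + p.2 = m := by simpa using hp
    have hc : (starRingEnd ℂ) w = Complex.exp (-(θ * Complex.I)) * x := by
      rw [hw, map_mul, ← Complex.exp_conj]
      simp
    have e : ((Ring.multichoose l p.1 : ℝ) : ℂ) * w ^ p.1 *
        (((Ring.multichoose l p.2 : ℝ) : ℂ) * (starRingEnd ℂ) w ^ p.2) =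
        ((Ring.multichoose l p.1 * Ring.multichoose l p.2 * x ^ m : ℝ) : ℂ) *
          Complex.exp ((((p.1 : ℝ) - p.2) * θ : ℝ) * Complex.I) := by
      rw [hc, hw, mul_pow, mul_pow, ← Complex.exp_nat_mul, ← Complex.exp_nat_mul, ← hp', pow_add]
      have : Complex.exp ((((p.1 : ℝ) - p.2) * θ : ℝ) * Complex.I) =
          Complex.exp (p.1 * (θ * Complex.I)) * Complex.exp (p.2 * -(θ * Complex.I)) := by
        rw [← Complex.exp_add]
        congr 1
        push_cast
        ring
      rw [this]
      push_cast
      ring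
    rw [e, Complex.re_ofReal_mul, Complex.exp_ofReal_mul_I_re]
    ring
  -- `1 - w` has positive real part, so it avoids the branch cut and conjugation commutes with the
  -- complex power.
  · have harg : (1 - w).arg ≠ Real.pi := by
      rw [Ne, Complex.arg_eq_pi_iff]
      rintro ⟨h, -⟩
      have := Complex.re_le_norm w
      simp at h
      linarith
    have e1 : (1 - (starRingEnd ℂ) w) ^ (l : ℂ) = (starRingEnd ℂ) ((1 - w) ^ (l : ℂ)) := by
      have := Complex.conj_cpow (1 - w) l harg
      simpa using this
    have hpos : 0 < ‖1 - w‖ := by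
      rw [norm_pos_iff]
      intro h
      have : w = 1 := (sub_eq_zero.1 h).symm
      rw [this] at hw1
      simp at hw1
    rw [e1, one_div_mul_one_div, Complex.mul_conj, Complex.normSq_eq_norm_sq,
      Complex.norm_cpow_real, one_sub_two_mul_cos_add_sq, ← hw]
    have e2 : ∀ y : ℝ, ((1 : ℂ) / (y : ℂ)).re = 1 / y := fun y => by
      rw [← Complex.ofReal_one, ← Complex.ofReal_div, Complex.ofReal_re]
    rw [e2, Real.rpow_neg (by positivity), one_div,
      ← Real.rpow_natCast, ← Real.rpow_natCast, ← Real.rpow_mul hpos.le, ← Real.rpow_mul hpos.le,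
      mul_comm l]

/-- Uniqueness of power series: any expansion on `|x| < 1` identifies the Taylor coefficients by
which `gegenbauer` is defined. -/
theorem iteratedDeriv_div_factorial_eq_of_hasSum {f : ℝ → ℝ} {c : ℕ → ℝ}
    (h : ∀ x : ℝ, |x| < 1 → HasSum (fun m => c m * x ^ m) (f x)) (m : ℕ) :
    iteratedDeriv m f 0 / (m.factorial : ℝ) = c m := by
  have h1 : HasFPowerSeriesAt f (FormalMultilinearSeries.ofScalars ℝ c) 0 := by
    rw [hasFPowerSeriesAt_iff]
    filter_upwards [Metric.ball_mem_nhds (0 : ℝ) one_pos] with x hx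
    simpa [FormalMultilinearSeries.coeff_ofScalars, mul_comm] using h x (by simpa using hx)
  have h2 := h1.eq_formalMultilinearSeries h1.analyticAt.hasFPowerSeriesAt
  have h3 := congrArg (fun p => p.coeff m) h2
  simpa [FormalMultilinearSeries.coeff_ofScalars] using h3.symm

theorem gegenbauer_cos {l : ℝ} (hl : 0 < l) (m : ℕ) (θ : ℝ) :
    gegenbauer l m (Real.cos θ) = gegenbauerCos l m θ :=
  iteratedDeriv_div_factorial_eq_of_hasSum (fun _ hx => hasSum_gegenbauerCos hl θ hx) m

/-- The sum is the real part of a geometric sum of a `k`-th root of unity, which is `k` or `0`. -/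
theorem sum_cos_nonneg {k : ℕ} (hk : k ≠ 0) (d : ℤ) :
    0 ≤ ∑ j ∈ range k, Real.cos ((d : ℝ) * (2 * Real.pi * j / k)) := by
  set w : ℂ := Complex.exp (((d : ℝ) * (2 * Real.pi / k) : ℝ) * Complex.I) with hw
  have e : ∑ j ∈ range k, Real.cos ((d : ℝ) * (2 * Real.pi * j / k)) =
      (∑ j ∈ range k, w ^ j).re := by
    rw [Complex.re_sum]
    refine Finset.sum_congr rfl fun j _ => ?_
    rw [hw, ← Complex.exp_nat_mul, ← Complex.exp_ofReal_mul_I_re]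
    congr 2
    push_cast
    ring
  have hk' : (k : ℂ) ≠ 0 := by exact_mod_cast hk
  have hwk : w ^ k = 1 := by
    rw [hw, ← Complex.exp_nat_mul, Complex.exp_eq_one_iff]
    refine ⟨d, ?_⟩
    push_cast
    field_simp
  rw [e]
  by_cases h1 : w = 1
  · simp [h1]
  · have := mul_geom_sum w k
    rw [hwk, sub_self] at this
    rcases mul_eq_zero.1 this with h | h
    · exact absurd (sub_eq_zero.1 h) h1
    · rw [h]
      simp

/-- The sum of the Gegenbauer polynomials over the `k`-th roots of unity. -/
noncomputable def orbitCoeff (l : ℝ) (k m : ℕ) : ℝ :=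
  ∑ j ∈ range k, gegenbauerCos l m (2 * Real.pi * j / k)

/-- After exchanging the sums, each frequency contributes a positive coefficient times a nonnegative
cosine sum. This positivity is what allows every later comparison to be made term by term. -/
theorem orbitCoeff_nonneg {l : ℝ} (hl : 0 < l) {k : ℕ} (hk : k ≠ 0) (m : ℕ) :
    0 ≤ orbitCoeff l k m := by
  unfold orbitCoeff gegenbauerCos
  rw [Finset.sum_comm]
  refine Finset.sum_nonneg fun p _ => ?_
  rw [← Finset.mul_sum]
  refine mul_nonneg (mul_pos (multichoose_real_pos hl _) (multichoose_real_pos hl _)).le ?_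
  simpa using sum_cos_nonneg hk ((p.1 : ℤ) - p.2)

theorem orbitCoeff_zero (l : ℝ) (k : ℕ) : orbitCoeff l k 0 = k := by
  simp [orbitCoeff, gegenbauerCos]

theorem rpow_neg_half_sq {x : ℝ} (hx : 0 ≤ x) (n : ℕ) :
    (x ^ 2) ^ (-((n : ℝ) / 2)) = (x ^ n)⁻¹ := by
  rw [Real.rpow_neg (by positivity), ← Real.rpow_natCast, ← Real.rpow_natCast,
    ← Real.rpow_mul hx]
  congr 2
  push_cast
  ring

/-- At `θ = 0` the generating function is `(1 - x)^{-(n+1)}`. -/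
theorem gegenbauerCos_at_zero (n m : ℕ) :
    gegenbauerCos (((n + 1 : ℕ) : ℝ) / 2) m 0 = ((m + n).choose n : ℝ) := by
  rw [← gegenbauer_cos (by positivity), gegenbauer]
  refine iteratedDeriv_div_factorial_eq_of_hasSum (c := fun m => ((m + n).choose n : ℝ))
    (fun x hx => ?_) m
  have h := hasSum_choose_mul_geometric_of_norm_lt_one n (r := x) (by simpa using hx)
  have e : 1 - 2 * Real.cos 0 * x + x ^ 2 = (1 - x) ^ 2 := by
    rw [Real.cos_zero]
    ring
  rw [e, rpow_neg_half_sq (by linarith [(abs_lt.1 hx).2]), ← one_div]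
  exact h

/-! ### Harmonic functions and the maximum principle -/

section Harmonic

variable {E : Type*} [NormedAddCommGroup E] [InnerProductSpace ℝ E]

variable (E) in
/-- The inner product as a continuous bilinear map over `ℝ`. -/
noncomputable def realInnerCLM : E →L[ℝ] E →L[ℝ] ℝ := innerSL ℝ

@[simp]
theorem realInnerCLM_apply (x y : E) : realInnerCLM E x y = inner ℝ x y := rfl

/-- A positive second derivative would make `a` a local minimum as well, so `f` would be locally
constant and its second derivative zero. -/
theorem IsLocalMax.deriv_deriv_nonpos {f : ℝ → ℝ} {a : ℝ} (h : IsLocalMax f a)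
    (hc : ContinuousAt f a) : deriv (deriv f) a ≤ 0 := by
  by_contra! hpos
  have hmin := isLocalMin_of_deriv_deriv_pos hpos h.deriv_eq_zero hc
  have he : f =ᶠ[𝓝 a] fun _ => f a := by
    filter_upwards [h, hmin] with x h1 h2
    exact le_antisymm h1 h2
  have := he.deriv.deriv.eq_of_nhds
  simp at this
  linarith

theorem IsLocalMax.fderiv_fderiv_nonpos {f : E → ℝ} {x : E} (h : IsLocalMax f x)
    (hf : ContDiffAt ℝ 2 f x) (v : E) : fderiv ℝ (fderiv ℝ f) x v v ≤ 0 := by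
  have hl : ∀ t : ℝ, HasDerivAt (fun t : ℝ => x + t • v) v t := fun t => by
    simpa using ((hasDerivAt_id t).smul_const v).const_add x
  have hx0 : x + (0 : ℝ) • v = x := by simp
  have hcont : Tendsto (fun t : ℝ => x + t • v) (𝓝 0) (𝓝 x) := by
    simpa using (hl 0).continuousAt.tendsto
  have hev : ∀ᶠ t : ℝ in 𝓝 0, ContDiffAt ℝ 2 f (x + t • v) :=
    hcont.eventually (hf.eventually (by simp))
  have hd : ∀ᶠ t : ℝ in 𝓝 0,
      deriv (fun t : ℝ => f (x + t • v)) t = fderiv ℝ f (x + t • v) v := by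
    filter_upwards [hev] with t ht
    exact ((ht.differentiableAt (by simp)).hasFDerivAt.comp_hasDerivAt t (hl t)).deriv
  have hf' : DifferentiableAt ℝ (fderiv ℝ f) (x + (0 : ℝ) • v) := by
    rw [hx0]
    exact (hf.fderiv_right (m := 1) (by norm_num)).differentiableAt (by simp)
  have hdd : deriv (deriv fun t : ℝ => f (x + t • v)) 0 = fderiv ℝ (fderiv ℝ f) x v v := by
    rw [EventuallyEq.deriv_eq hd]
    have h1 := hf'.hasFDerivAt.comp_hasDerivAt (0 : ℝ) (hl 0)
    rw [hx0] at h1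
    exact ((ContinuousLinearMap.apply ℝ ℝ v).hasFDerivAt.comp_hasDerivAt (0 : ℝ) h1).deriv
  rw [← hdd]
  refine IsLocalMax.deriv_deriv_nonpos ?_ ?_
  · have h2 : IsLocalMax f (x + (0 : ℝ) • v) := by rwa [hx0]
    exact h2.comp_continuous (g := fun t : ℝ => x + t • v) (hl 0).continuousAt
  · have h2 : ContinuousAt f (x + (0 : ℝ) • v) := by
      rw [hx0]
      exact hf.continuousAt
    exact ContinuousAt.comp (f := fun t : ℝ => x + t • v) h2 (hl 0).continuousAt

variable [FiniteDimensional ℝ E]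

theorem laplacian_eq_sum_fderiv {ι : Type*} [Fintype ι] (b : OrthonormalBasis ι ℝ E) (f : E → ℝ)
    (x : E) : Δ f x = ∑ i, fderiv ℝ (fderiv ℝ f) x (b i) (b i) := by
  rw [InnerProductSpace.laplacian_eq_iteratedFDeriv_orthonormalBasis f b]
  simp [iteratedFDeriv_two_apply]

theorem IsLocalMax.laplacian_nonpos {f : E → ℝ} {x : E} (h : IsLocalMax f x)
    (hf : ContDiffAt ℝ 2 f x) : Δ f x ≤ 0 := by
  rw [laplacian_eq_sum_fderiv (stdOrthonormalBasis ℝ E)]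
  exact Finset.sum_nonpos fun i _ => h.fderiv_fderiv_nonpos hf _

theorem laplacian_norm_sq (x : E) :
    Δ (fun y : E => ‖y‖ ^ 2) x = 2 * Module.finrank ℝ E := by
  rw [laplacian_eq_sum_fderiv (stdOrthonormalBasis ℝ E)]
  have h1 : fderiv ℝ (fun y : E => ‖y‖ ^ 2) = ⇑((2 : ℝ) • realInnerCLM E) := by
    funext y
    rw [(hasStrictFDerivAt_norm_sq y).hasFDerivAt.fderiv]
    ext v
    simp
  rw [h1, ContinuousLinearMap.fderiv]
  simp [mul_comm]

/-- The weak maximum principle on a bounded open set. -/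
theorem InnerProductSpace.HarmonicOnNhd.nonpos_of_frontier [Nontrivial E] {u : E → ℝ} {Ω : Set E}
    (ho : IsOpen Ω) (hb : Bornology.IsBounded Ω) (hu : InnerProductSpace.HarmonicOnNhd u Ω)
    (hc : ContinuousOn u (closure Ω)) (hf : ∀ x ∈ frontier Ω, u x ≤ 0) :
    ∀ x ∈ closure Ω, u x ≤ 0 := by
  intro x₀ hx₀
  by_contra! hpos
  obtain ⟨R, hR⟩ := hb.closure.exists_norm_le
  -- This `ε` is small enough that `u + ε‖x‖²` still attains its maximum inside `Ω`, where its
  -- Laplacian is `2 ε dim E > 0`, a contradiction.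
  set ε : ℝ := u x₀ / (R ^ 2 + 1) with hε
  have hε0 : 0 < ε := by positivity
  have hsmall : ∀ x ∈ closure Ω, ε * ‖x‖ ^ 2 < u x₀ := fun x hx => by
    have h1 : ‖x‖ ^ 2 ≤ R ^ 2 := by
      gcongr
      exact hR x hx
    have h2 : ε * (R ^ 2 + 1) = u x₀ := by rw [hε]; field_simp
    nlinarith
  have hcv : ContinuousOn (fun x => u x + ε * ‖x‖ ^ 2) (closure Ω) := by fun_prop
  obtain ⟨x₁, hx₁, hmax⟩ := hb.isCompact_closure.exists_isMaxOn ⟨x₀, hx₀⟩ hcv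
  have hge : u x₀ ≤ u x₁ + ε * ‖x₁‖ ^ 2 := by
    have h1 : u x₀ + ε * ‖x₀‖ ^ 2 ≤ u x₁ + ε * ‖x₁‖ ^ 2 := hmax hx₀
    have : 0 ≤ ε * ‖x₀‖ ^ 2 := by positivity
    linarith
  have hin : x₁ ∈ Ω := by
    by_contra hn
    have h1 : x₁ ∈ frontier Ω := by
      rw [ho.frontier_eq]
      exact ⟨hx₁, hn⟩
    have := hf x₁ h1
    have := hsmall x₁ hx₁
    linarith
  have hloc : IsLocalMax (u + ε • fun x : E => ‖x‖ ^ 2) x₁ := by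
    filter_upwards [ho.mem_nhds hin] with y hy
    exact hmax (subset_closure hy)
  have hn2 : ContDiffAt ℝ 2 (fun x : E => ‖x‖ ^ 2) x₁ := (contDiff_norm_sq ℝ).contDiffAt
  have hn3 : ContDiffAt ℝ 2 (ε • fun x : E => ‖x‖ ^ 2) x₁ := hn2.const_smul ε
  have hle := hloc.laplacian_nonpos ((hu x₁ hin).1.add hn3)
  rw [(hu x₁ hin).1.laplacian_add hn3, InnerProductSpace.laplacian_smul ε hn2,
    (hu x₁ hin).2.eq_of_nhds, laplacian_norm_sq] at hle
  have : 0 < Module.finrank ℝ E := Module.finrank_pos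
  have h4 : (0 : ℝ) < Module.finrank ℝ E := by exact_mod_cast this
  simp at hle
  have : 0 < ε * (2 * (Module.finrank ℝ E : ℝ)) := by positivity
  linarith

theorem InnerProductSpace.HarmonicOnNhd.eqOn_of_frontier [Nontrivial E] {u v : E → ℝ} {Ω : Set E}
    (ho : IsOpen Ω) (hb : Bornology.IsBounded Ω) (hu : InnerProductSpace.HarmonicOnNhd u Ω)
    (hv : InnerProductSpace.HarmonicOnNhd v Ω) (huc : ContinuousOn u (closure Ω))
    (hvc : ContinuousOn v (closure Ω)) (hf : ∀ x ∈ frontier Ω, u x = v x) :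
    Set.EqOn u v (closure Ω) := by
  intro x hx
  have h1 := (hu.sub hv).nonpos_of_frontier ho hb (huc.sub hvc)
    (fun x hx => by simp [hf x hx]) x hx
  have h2 := (hv.sub hu).nonpos_of_frontier ho hb (hvc.sub huc)
    (fun x hx => by simp [hf x hx]) x hx
  simp only [Pi.sub_apply] at h1 h2
  linarith

/-- Harmonicity includes being `C²`, which explicit first and second derivatives provide once the
second is continuous. This suits series that are differentiated term by term. -/
theorem harmonicOnNhd_of_hasFDerivAt {ι : Type*} [Fintype ι] (b : OrthonormalBasis ι ℝ E)
    {f : E → ℝ} {f' : E → E →L[ℝ] ℝ} {f'' : E → E →L[ℝ] E →L[ℝ] ℝ} {s : Set E} (hs : IsOpen s)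
    (h1 : ∀ x ∈ s, HasFDerivAt f (f' x) x) (h2 : ∀ x ∈ s, HasFDerivAt f' (f'' x) x)
    (h3 : ContinuousOn f'' s) (h4 : ∀ x ∈ s, ∑ i, f'' x (b i) (b i) = 0) :
    InnerProductSpace.HarmonicOnNhd f s := by
  have e1 : Set.EqOn (fderiv ℝ f) f' s := fun x hx => (h1 x hx).fderiv
  have e2 : ∀ x ∈ s, HasFDerivAt (fderiv ℝ f) (f'' x) x := fun x hx =>
    (h2 x hx).congr_of_eventuallyEq (e1.eventuallyEq_of_mem (hs.mem_nhds hx))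
  have e3 : Set.EqOn (fderiv ℝ (fderiv ℝ f)) f'' s := fun x hx => (e2 x hx).fderiv
  have c1 : ContDiffOn ℝ 1 (fderiv ℝ f) s := by
    rw [show (1 : WithTop ℕ∞) = 0 + 1 by norm_num, contDiffOn_succ_iff_fderiv_of_isOpen hs]
    exact ⟨fun x hx => (e2 x hx).differentiableAt.differentiableWithinAt, by simp,
      contDiffOn_zero.2 (h3.congr e3)⟩
  have c2 : ContDiffOn ℝ 2 f s := by
    rw [show (2 : WithTop ℕ∞) = 1 + 1 by norm_num, contDiffOn_succ_iff_fderiv_of_isOpen hs]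
    exact ⟨fun x hx => (h1 x hx).differentiableAt.differentiableWithinAt, by simp, c1⟩
  intro x hx
  refine ⟨c2.contDiffAt (hs.mem_nhds hx), ?_⟩
  filter_upwards [hs.mem_nhds hx] with y hy
  rw [laplacian_eq_sum_fderiv b, e3 hy, h4 y hy]
  rfl

end Harmonic

/-! ### The Newtonian kernel and its derivatives -/

section Newton

variable {E : Type*} [NormedAddCommGroup E] [InnerProductSpace ℝ E]

/-- The first derivative of `‖z‖⁻ⁿ`. -/
noncomputable def newtonD1 (n : ℕ) (z : E) :
    E →L[ℝ] ℝ :=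
  (-(n : ℝ) * (‖z‖ ^ 2) ^ (-((n : ℝ) / 2) - 1)) • realInnerCLM E z

/-- The second derivative of `‖z‖⁻ⁿ`. -/
noncomputable def newtonD2 (n : ℕ) (z : E) :
    E →L[ℝ] E →L[ℝ] ℝ :=
  (-(n : ℝ) * (‖z‖ ^ 2) ^ (-((n : ℝ) / 2) - 1)) • realInnerCLM E +
    ((n * (n + 2) * (‖z‖ ^ 2) ^ (-((n : ℝ) / 2) - 2)) • realInnerCLM E z).smulRight (realInnerCLM E z)

theorem hasFDerivAt_norm_sq_rpow (p : ℝ) {z : E} (hz : z ≠ 0) :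
    HasFDerivAt (fun z : E => (‖z‖ ^ 2) ^ p)
      ((2 * p * (‖z‖ ^ 2) ^ (p - 1)) • realInnerCLM E z) z := by
  have h := (hasStrictFDerivAt_norm_sq z).hasFDerivAt.rpow_const (p := p)
    (Or.inl (by positivity : ‖z‖ ^ 2 ≠ 0))
  convert h using 1
  ext v
  simp
  ring

theorem hasFDerivAt_newton (n : ℕ) {z : E} (hz : z ≠ 0) :
    HasFDerivAt (fun z : E => (‖z‖ ^ n)⁻¹) (newtonD1 n z) z := by
  have h := hasFDerivAt_norm_sq_rpow (-((n : ℝ) / 2)) hz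
  have e : (fun z : E => (‖z‖ ^ 2) ^ (-((n : ℝ) / 2))) =
      fun z => (‖z‖ ^ n)⁻¹ := by
    funext z
    exact rpow_neg_half_sq (norm_nonneg z) n
  rw [e] at h
  refine h.congr_fderiv ?_
  unfold newtonD1
  congr 1
  ring

theorem hasFDerivAt_newtonD1 (n : ℕ) {z : E} (hz : z ≠ 0) :
    HasFDerivAt (newtonD1 (E := E) n) (newtonD2 n z) z := by
  have h := ((hasFDerivAt_norm_sq_rpow (-((n : ℝ) / 2) - 1) hz).const_mul (-(n : ℝ))).smul
    (realInnerCLM E).hasFDerivAt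
  refine h.congr_fderiv ?_
  unfold newtonD2
  congr 2
  rw [smul_smul, show -((n : ℝ) / 2) - 1 - 1 = -((n : ℝ) / 2) - 2 by ring]
  congr 1
  ring

theorem continuousOn_newtonD1 (n : ℕ) : ContinuousOn (newtonD1 (E := E) n) {0}ᶜ := fun z hz =>
  (hasFDerivAt_newtonD1 n (by simpa using hz)).continuousAt.continuousWithinAt

theorem continuousOn_newtonD2 (n : ℕ) : ContinuousOn (newtonD2 (E := E) n) {0}ᶜ := by
  intro z hz
  have hz' : z ≠ 0 := by simpa using hz
  have c : ∀ p : ℝ, ContinuousAt (fun z : E => (‖z‖ ^ 2) ^ p) z := fun p =>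
    (hasFDerivAt_norm_sq_rpow p hz').continuousAt
  have c1 := c (-((n : ℝ) / 2) - 1)
  have c2 := c (-((n : ℝ) / 2) - 2)
  refine ContinuousAt.continuousWithinAt ?_
  have c3 : ContinuousAt (fun z : E => realInnerCLM E z) z :=
    (realInnerCLM E).continuous.continuousAt
  have c4 := (continuousAt_const (y := (n : ℝ) * (n + 2))).mul c2 |>.smul c3
  have c5 := ((ContinuousLinearMap.smulRightL ℝ (E)
    (E →L[ℝ] ℝ)).continuous.continuousAt.comp c4).clm_apply c3
  exact (((continuousAt_const (y := -(n : ℝ))).mul c1).smul continuousAt_const).add c5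

/-- The two parts of the trace are `-n · dim · ‖z‖^{-n-2}` and `n (n + 2) ‖z‖^{-n-2}`; they cancel
because the dimension is `n + 2`. -/
theorem sum_newtonD2 {ι : Type*} [Fintype ι] (b : OrthonormalBasis ι ℝ E) {n : ℕ}
    (hn : Fintype.card ι = n + 2) {z : E} (hz : z ≠ 0) :
    ∑ i, newtonD2 n z (b i) (b i)
      = 0 := by
  have hp : 0 < ‖z‖ ^ 2 := by positivity
  have e : (‖z‖ ^ 2) ^ (-((n : ℝ) / 2) - 1) = (‖z‖ ^ 2) ^ (-((n : ℝ) / 2) - 2) * ‖z‖ ^ 2 := by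
    rw [← Real.rpow_add_one hp.ne']
    congr 1
    ring
  have h := b.sum_sq_inner_right z
  have h' : ∀ i, newtonD2 n z (b i)
      (b i) = -(n : ℝ) * (‖z‖ ^ 2) ^ (-((n : ℝ) / 2) - 1) +
        (n * (n + 2) * (‖z‖ ^ 2) ^ (-((n : ℝ) / 2) - 2)) *
          inner ℝ (b i) z ^ 2 := by
    intro i
    rw [newtonD2]
    simp only [_root_.add_apply, _root_.smul_apply,
      ContinuousLinearMap.smulRight_apply, realInnerCLM_apply, real_inner_self_eq_norm_sq,
      OrthonormalBasis.norm_eq_one, smul_eq_mul, real_inner_comm z]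
    ring
  rw [Finset.sum_congr rfl fun i _ => h' i, Finset.sum_add_distrib, ← Finset.mul_sum, ← Finset.mul_sum, h,
    Finset.sum_const, Finset.card_univ, e]
  simp [hn]
  ring

theorem exists_bound_newton [FiniteDimensional ℝ E] (n : ℕ) {δ : ℝ} (hδ : 0 < δ) (R : ℝ) :
    ∃ C : ℝ, ∀ z : E, δ ≤ ‖z‖ → ‖z‖ ≤ R →
      ‖newtonD1 n z‖ ≤ C ∧ ‖newtonD2 n z‖ ≤ C := by
  have hK : IsCompact (Metric.closedBall (0 : E) R \ Metric.ball 0 δ) :=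
    (isCompact_closedBall 0 R).diff Metric.isOpen_ball
  have hsub : Metric.closedBall (0 : E) R \ Metric.ball 0 δ ⊆ {0}ᶜ := by
    rintro z ⟨-, hz⟩ rfl
    exact hz (Metric.mem_ball_self hδ)
  obtain ⟨C1, h1⟩ := hK.exists_bound_of_continuousOn ((continuousOn_newtonD1 n).mono hsub)
  obtain ⟨C2, h2⟩ := hK.exists_bound_of_continuousOn (E := E →L[ℝ] E →L[ℝ] ℝ)
    ((continuousOn_newtonD2 n).mono hsub)
  refine ⟨max C1 C2, fun z hz1 hz2 => ?_⟩
  have hz : z ∈ Metric.closedBall (0 : E) R \ Metric.ball 0 δ := by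
    simp [hz1, hz2]
  exact ⟨(h1 z hz).trans (le_max_left _ _), (h2 z hz).trans (le_max_right _ _)⟩

end Newton

/-! ### Series of image charges for the annulus -/

section ImageSeries

variable {E : Type*} [NormedAddCommGroup E] [InnerProductSpace ℝ E]

/-- The potential of infinitely many charges `w i` at points of the line spanned by `e`. -/
noncomputable def chargeSeries (n : ℕ) (w a b : ℕ → ℝ) (e x : E) : ℝ :=
  ∑' i, w i * (‖a i • e + b i • x‖ ^ n)⁻¹

theorem norm_charge_le {n : ℕ} {w d δ : ℝ} (hδ : 0 < δ) (hd : δ ≤ d) :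
    ‖w * (d ^ n)⁻¹‖ ≤ |w| * (δ ^ n)⁻¹ := by
  have hd0 : 0 < d := hδ.trans_le hd
  rw [norm_mul, Real.norm_eq_abs, Real.norm_of_nonneg (by positivity)]
  gcongr

theorem summable_charge {n : ℕ} {w a b : ℕ → ℝ} (hw : Summable fun i => |w i|) {e x : E} {δ : ℝ}
    (hδ : 0 < δ) (h : ∀ i, δ ≤ ‖a i • e + b i • x‖) :
    Summable fun i => w i * (‖a i • e + b i • x‖ ^ n)⁻¹ :=
  Summable.of_norm_bounded (hw.mul_right _) fun i => norm_charge_le hδ (h i)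

theorem continuousOn_chargeSeries {n : ℕ} {w a b : ℕ → ℝ} (hw : Summable fun i => |w i|) {e : E}
    {s : Set E} {δ : ℝ} (hδ : 0 < δ) (h : ∀ i, ∀ x ∈ s, δ ≤ ‖a i • e + b i • x‖) :
    ContinuousOn (chargeSeries n w a b e) s := by
  refine continuousOn_tsum (fun i => ?_) (hw.mul_right (δ ^ n)⁻¹)
    fun i x hx => norm_charge_le hδ (h i x hx)
  refine continuousOn_const.mul (ContinuousOn.inv₀ (by fun_prop) fun x hx => ?_)
  exact pow_ne_zero _ (hδ.trans_le (h i x hx)).ne'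

theorem norm_smul_le_of_abs_le_one {F : Type*} [NormedAddCommGroup F] [NormedSpace ℝ F] {A : F}
    {w b C : ℝ} (hb : |b| ≤ 1) (hA : ‖A‖ ≤ C) : ‖(w * b) • A‖ ≤ |w| * C := by
  rw [norm_smul, norm_mul, Real.norm_eq_abs, Real.norm_eq_abs]
  calc |w| * |b| * ‖A‖ ≤ |w| * 1 * C := by gcongr
    _ = |w| * C := by ring

theorem HasSum.clm_apply_const {F G : Type*} [NormedAddCommGroup F] [NormedSpace ℝ F]
    [NormedAddCommGroup G] [NormedSpace ℝ G] {A : ℕ → F →L[ℝ] G} {a : F →L[ℝ] G}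
    (h : HasSum A a) (v : F) : HasSum (fun i => A i v) (a v) :=
  (ContinuousLinearMap.apply ℝ G v).hasSum h

theorem summable_of_norm_le {F : Type*} [NormedAddCommGroup F] [CompleteSpace F] {A : ℕ → F}
    {u : ℕ → ℝ} (hu : Summable u) (h : ∀ i, ‖A i‖ ≤ u i) : HasSum A (∑' i, A i) :=
  (Summable.of_norm_bounded hu h).hasSum

theorem ContinuousOn.const_smul_fun {X F : Type*} [TopologicalSpace X] [NormedAddCommGroup F]
    [NormedSpace ℝ F] {A : X → F} {s : Set X} (h : ContinuousOn A s) (c : ℝ) :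
    ContinuousOn (fun x => c • A x) s := h.const_smul c

/-- The series is differentiated twice term by term. The bounds `δ` and `R` keep all arguments in
one compact shell away from the singularity, and `|b i| ≤ 1` keeps the chain-rule factors from
spoiling the majorant `|w i| * C`. -/
theorem harmonicOnNhd_chargeSeries [FiniteDimensional ℝ E] {n : ℕ}
    (hE : Module.finrank ℝ E = n + 2) {w a b : ℕ → ℝ}
    (hw : Summable fun i => |w i|) (hb : ∀ i, |b i| ≤ 1) {e : E} {s : Set E} (hs : IsOpen s)
    {δ R : ℝ} (hδ : 0 < δ)
    (h : ∀ i, ∀ x ∈ s, δ ≤ ‖a i • e + b i • x‖ ∧ ‖a i • e + b i • x‖ ≤ R) :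
    InnerProductSpace.HarmonicOnNhd (chargeSeries n w a b e) s := by
  obtain ⟨C, hC⟩ := exists_bound_newton (E := E) n hδ R
  have hne : ∀ i, ∀ x ∈ s, a i • e + b i • x ≠ 0 := fun i x hx h0 => by
    have := (h i x hx).1
    rw [h0, norm_zero] at this
    linarith
  have hz : ∀ i x, HasFDerivAt (fun x : E => a i • e + b i • x)
      (b i • ContinuousLinearMap.id ℝ E) x := fun i x =>
    ((hasFDerivAt_id x).const_smul (b i)).const_add _
  let D1 : ℕ → E → E →L[ℝ] ℝ := fun i x => (w i * b i) • newtonD1 n (a i • e + b i • x)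
  let D2 : ℕ → E → E →L[ℝ] E →L[ℝ] ℝ :=
    fun i x => (w i * b i ^ 2) • newtonD2 n (a i • e + b i • x)
  have hd1 : ∀ i, ∀ x ∈ s,
      HasFDerivAt (fun x => w i * (‖a i • e + b i • x‖ ^ n)⁻¹) (D1 i x) x := by
    intro i x hx
    have h1 := ((hasFDerivAt_newton n (hne i x hx)).comp x (hz i x)).const_mul (w i)
    refine h1.congr_fderiv ?_
    ext v
    simp [D1, mul_assoc]
  have hd2 : ∀ i, ∀ x ∈ s, HasFDerivAt (D1 i) (D2 i x) x := by
    intro i x hx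
    have h1 := ((hasFDerivAt_newtonD1 n (hne i x hx)).comp x (hz i x)).const_smul (w i * b i)
    refine h1.congr_fderiv ?_
    ext v u
    simp [D2]
    ring
  have hu : Summable fun i => |w i| * C := hw.mul_right C
  have hb1 : ∀ i, ∀ x ∈ s, ‖D1 i x‖ ≤ |w i| * C := fun i x hx =>
    norm_smul_le_of_abs_le_one (hb i) (hC _ (h i x hx).1 (h i x hx).2).1
  have hb2 : ∀ i, ∀ x ∈ s, ‖D2 i x‖ ≤ |w i| * C := fun i x hx =>
    norm_smul_le_of_abs_le_one (F := E →L[ℝ] E →L[ℝ] ℝ)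
      (by rw [abs_pow]; exact pow_le_one₀ (abs_nonneg _) (hb i))
      (hC _ (h i x hx).1 (h i x hx).2).2
  -- Termwise differentiation is applied on a preconnected open set, so a ball is taken around each
  -- point.
  have hball : ∀ x ∈ s, ∃ t ⊆ s, IsOpen t ∧ IsPreconnected t ∧ x ∈ t := fun x hx => by
    obtain ⟨r, hr, hsub⟩ := Metric.isOpen_iff.1 hs x hx
    exact ⟨Metric.ball x r, hsub, Metric.isOpen_ball, (convex_ball x r).isPreconnected,
      Metric.mem_ball_self hr⟩
  have hc2 : ∀ i, ContinuousOn (D2 i) s := by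
    intro i
    exact ContinuousOn.const_smul_fun (F := E →L[ℝ] E →L[ℝ] ℝ) ((continuousOn_newtonD2 n).comp
      (by fun_prop) fun x hx => by simpa using hne i x hx) _
  refine harmonicOnNhd_of_hasFDerivAt (stdOrthonormalBasis ℝ E) (f' := fun x => ∑' i, D1 i x)
    (f'' := fun x => ∑' i, D2 i x) hs ?_ ?_ ?_ ?_
  · intro x hx
    obtain ⟨t, hts, ho, hp, hxt⟩ := hball x hx
    exact hasFDerivAt_tsum_of_isPreconnected hu ho hp (fun i y hy => hd1 i y (hts hy))
      (fun i y hy => hb1 i y (hts hy)) hxt (summable_charge hw hδ fun i => (h i x hx).1) hxt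
  · intro x hx
    obtain ⟨t, hts, ho, hp, hxt⟩ := hball x hx
    exact hasFDerivAt_tsum_of_isPreconnected hu ho hp (fun i y hy => hd2 i y (hts hy))
      (fun i y hy => hb2 i y (hts hy)) hxt
      (Summable.of_norm_bounded hu fun i => hb1 i x hx) hxt
  · exact continuousOn_tsum (F := E →L[ℝ] E →L[ℝ] ℝ) hc2 hu hb2
  · intro x hx
    let B := stdOrthonormalBasis ℝ E
    have hsum := summable_of_norm_le (F := E →L[ℝ] E →L[ℝ] ℝ) hu fun i => hb2 i x hx
    have h1 : HasSum (fun i => ∑ j, D2 i x (B j) (B j)) (∑ j, (∑' i, D2 i x) (B j) (B j)) :=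
      hasSum_sum fun j _ => (hsum.clm_apply_const (G := E →L[ℝ] ℝ) (B j)).clm_apply_const (B j)
    refine h1.unique ?_
    have h0 : ∀ i, ∑ j, D2 i x (B j) (B j) = 0 := fun i => by
      have h2 := sum_newtonD2 B (by simpa using hE) (hne i x hx)
      calc ∑ j, D2 i x (B j) (B j) =
          ∑ j, w i * b i ^ 2 * newtonD2 n (a i • e + b i • x) (B j) (B j) := rfl
        _ = 0 := by rw [← Finset.mul_sum, h2, mul_zero]
    simp only [h0]
    exact hasSum_zero

theorem norm_sq_comb {e x : E} (he : ‖e‖ = 1) (a b : ℝ) :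
    ‖a • e + b • x‖ ^ 2 = a ^ 2 + 2 * (a * b) * inner ℝ e x + b ^ 2 * ‖x‖ ^ 2 := by
  rw [norm_add_sq_real, norm_smul, norm_smul, mul_pow, mul_pow, he, inner_smul_left,
    inner_smul_right]
  simp
  ring

/-- For a unit vector `e` the norm depends on the coefficients only through `a² + b²‖x‖²` and `a b`.
This reduces reflection in a sphere to algebra. -/
theorem norm_comb_eq {e x : E} (he : ‖e‖ = 1) {a b a' b' c : ℝ} (hc : 0 ≤ c)
    (h1 : c ^ 2 * (a ^ 2 + b ^ 2 * ‖x‖ ^ 2) = a' ^ 2 + b' ^ 2 * ‖x‖ ^ 2)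
    (h2 : c ^ 2 * (a * b) = a' * b') :
    ‖a' • e + b' • x‖ = c * ‖a • e + b • x‖ := by
  rw [← sq_eq_sq₀ (norm_nonneg _) (by positivity), mul_pow, norm_sq_comb he, norm_sq_comb he]
  linear_combination (-1) * h1 - 2 * inner ℝ e x * h2

theorem le_norm_comb {e x : E} (he : ‖e‖ = 1) (a b : ℝ) :
    |a| - |b| * ‖x‖ ≤ ‖a • e + b • x‖ ∧ |b| * ‖x‖ - |a| ≤ ‖a • e + b • x‖ ∧
      ‖a • e + b • x‖ ≤ |a| + |b| * ‖x‖ := by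
  have h1 := norm_sub_le_norm_add (a • e) (b • x)
  have h2 := norm_sub_le_norm_add (b • x) (a • e)
  have h3 := norm_add_le (a • e) (b • x)
  rw [norm_smul, norm_smul, he, Real.norm_eq_abs, Real.norm_eq_abs, mul_one] at h1 h2 h3
  rw [add_comm (b • x)] at h2
  exact ⟨h1, h2, h3⟩

/-- The regular part of the Green function of the annulus, up to normalization, by the method of
images: `s` is the norm of the pole and `e` its direction. -/
noncomputable def imageSeries (n : ℕ) (ρ s : ℝ) (e x : E) : ℝ :=
  chargeSeries n (fun i => ρ ^ (n * i)) (fun _ => 1) (fun i => -(ρ ^ (2 * i) * s)) e x -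
    chargeSeries n (fun i => ρ ^ (n * (i + 1)) * (s ^ n)⁻¹) (fun _ => 1)
      (fun i => -(ρ ^ (2 * (i + 1)) * s⁻¹)) e x +
    chargeSeries n (fun i => ρ ^ (n * (i + 1)) * (s ^ n)⁻¹) (fun i => ρ ^ (2 * (i + 1)) * s⁻¹)
      (fun _ => -1) e x -
    chargeSeries n (fun i => ρ ^ (n * (i + 1))) (fun i => ρ ^ (2 * (i + 1)) * s) (fun _ => -1) e x

section Bounds

variable {n : ℕ} {ρ s : ℝ}

theorem summable_pow_mul (hn : n ≠ 0) (h0 : 0 < ρ) (h1 : ρ < 1) :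
    Summable fun i => |ρ ^ (n * i)| := by
  have : ρ ^ n < 1 := pow_lt_one₀ h0.le h1 hn
  refine (summable_geometric_of_lt_one (by positivity) this).congr fun i => ?_
  rw [pow_mul, abs_of_nonneg (by positivity)]

theorem summable_pow_mul_succ (hn : n ≠ 0) (h0 : 0 < ρ) (h1 : ρ < 1) :
    Summable fun i => |ρ ^ (n * (i + 1))| :=
  (summable_nat_add_iff (f := fun i => |ρ ^ (n * i)|) 1).2 (summable_pow_mul hn h0 h1)

theorem summable_pow_mul_succ_mul (hn : n ≠ 0) (h0 : 0 < ρ) (h1 : ρ < 1) (c : ℝ) :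
    Summable fun i => |ρ ^ (n * (i + 1)) * c| := by
  simp only [abs_mul]
  exact (summable_pow_mul_succ hn h0 h1).mul_right _

theorem pow_two_mul_succ_le (h0 : 0 < ρ) (h1 : ρ < 1) (i : ℕ) : ρ ^ (2 * (i + 1)) ≤ ρ ^ 2 :=
  pow_le_pow_of_le_one h0.le h1.le (by omega)

theorem pow_two_mul_succ_div_le (h0 : 0 < ρ) (h1 : ρ < 1) (hs : ρ < s) (i : ℕ) :
    ρ ^ (2 * (i + 1)) * s⁻¹ ≤ ρ ^ 2 * s⁻¹ ∧ ρ ^ 2 * s⁻¹ < ρ := by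
  have hs0 : 0 < s := h0.trans hs
  constructor
  · exact mul_le_mul_of_nonneg_right (pow_two_mul_succ_le h0 h1 i) (by positivity)
  · rw [← div_eq_mul_inv, div_lt_iff₀ hs0]
    nlinarith

theorem pow_two_mul_le (h0 : 0 < ρ) (h1 : ρ < 1) (hs0 : 0 < s) (i : ℕ) :
    ρ ^ (2 * i) * s ≤ s := by
  have : ρ ^ (2 * i) ≤ 1 := pow_le_one₀ h0.le h1.le
  nlinarith

theorem pow_two_mul_succ_mul_le (h0 : 0 < ρ) (h1 : ρ < 1) (hs : ρ < s) (hs1 : s < 1) (i : ℕ) :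
    ρ ^ (2 * (i + 1)) * s ≤ ρ ^ 2 := by
  have h := pow_two_mul_succ_le h0 h1 i
  have : 0 ≤ ρ ^ (2 * (i + 1)) := by positivity
  nlinarith

variable (h0 : 0 < ρ) (h1 : ρ < 1) (hs : ρ < s) (hs1 : s < 1)

include h0 h1 hs hs1 in
-- The first two families of images lie outside the unit ball and the last two inside the hole, at
-- distances from the closed annulus that do not shrink with `i`. The third gap `ρ - ρ²/s` is
-- positive because `ρ < s`.
theorem image_bound {e x : E} (he : ‖e‖ = 1) (hx : ρ ≤ ‖x‖) (hx1 : ‖x‖ ≤ 1) (i : ℕ) :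
    (1 - s ≤ ‖(1 : ℝ) • e + (-(ρ ^ (2 * i) * s)) • x‖ ∧
      ‖(1 : ℝ) • e + (-(ρ ^ (2 * i) * s)) • x‖ ≤ 2) ∧
    (1 - ρ ≤ ‖(1 : ℝ) • e + (-(ρ ^ (2 * (i + 1)) * s⁻¹)) • x‖ ∧
      ‖(1 : ℝ) • e + (-(ρ ^ (2 * (i + 1)) * s⁻¹)) • x‖ ≤ 2) ∧
    (ρ - ρ ^ 2 * s⁻¹ ≤ ‖(ρ ^ (2 * (i + 1)) * s⁻¹) • e + (-1 : ℝ) • x‖ ∧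
      ‖(ρ ^ (2 * (i + 1)) * s⁻¹) • e + (-1 : ℝ) • x‖ ≤ 2) ∧
    (ρ - ρ ^ 2 ≤ ‖(ρ ^ (2 * (i + 1)) * s) • e + (-1 : ℝ) • x‖ ∧
      ‖(ρ ^ (2 * (i + 1)) * s) • e + (-1 : ℝ) • x‖ ≤ 2) := by
  have hs0 : 0 < s := h0.trans hs
  have a1 := pow_two_mul_le h0 h1 hs0 i
  have a2 := pow_two_mul_succ_div_le h0 h1 hs i
  have a4 := pow_two_mul_succ_mul_le h0 h1 hs hs1 i
  have p1 : 0 < ρ ^ (2 * i) * s := by positivity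
  have p2 : 0 < ρ ^ (2 * (i + 1)) * s⁻¹ := by positivity
  have p4 : 0 < ρ ^ (2 * (i + 1)) * s := by positivity
  have hρ2 : ρ ^ 2 < 1 := by nlinarith
  have b1 := le_norm_comb (x := x) he 1 (-(ρ ^ (2 * i) * s))
  have b2 := le_norm_comb (x := x) he 1 (-(ρ ^ (2 * (i + 1)) * s⁻¹))
  have b3 := le_norm_comb (x := x) he (ρ ^ (2 * (i + 1)) * s⁻¹) (-1)
  have b4 := le_norm_comb (x := x) he (ρ ^ (2 * (i + 1)) * s) (-1)
  simp only [abs_neg, abs_one, abs_of_pos p1, abs_of_pos p2, abs_of_pos p4, one_mul] at b1 b2 b3 b4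
  have m1 : ρ ^ (2 * i) * s * ‖x‖ ≤ ρ ^ (2 * i) * s := by nlinarith
  have m2 : ρ ^ (2 * (i + 1)) * s⁻¹ * ‖x‖ ≤ ρ ^ (2 * (i + 1)) * s⁻¹ := by nlinarith
  refine ⟨⟨?_, ?_⟩, ⟨?_, ?_⟩, ⟨?_, ?_⟩, ⟨?_, ?_⟩⟩ <;> linarith [b1.1, b1.2.2, b2.1, b2.2.2, b3.2.1,
    b3.2.2, b4.2.1, b4.2.2, a2.1, a2.2]

include h0 h1 hs hs1 in
theorem summable_image {e x : E} (hn : n ≠ 0) (he : ‖e‖ = 1) (hx : ρ ≤ ‖x‖) (hx1 : ‖x‖ ≤ 1) :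
    (Summable fun i : ℕ => ρ ^ (n * i) *
      (‖(1 : ℝ) • e + (-(ρ ^ (2 * i) * s)) • x‖ ^ n)⁻¹) ∧
    (Summable fun i : ℕ => ρ ^ (n * (i + 1)) * (s ^ n)⁻¹ *
      (‖(ρ ^ (2 * (i + 1)) * s⁻¹) • e + (-1 : ℝ) • x‖ ^ n)⁻¹) := by
  have b := image_bound h0 h1 hs hs1 he hx hx1
  have a2 := pow_two_mul_succ_div_le h0 h1 hs 0
  exact ⟨summable_charge (a := fun _ => 1) (b := fun i => -(ρ ^ (2 * i) * s))
      (summable_pow_mul hn h0 h1) (by linarith : 0 < 1 - s) fun i => (b i).1.1,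
    summable_charge (a := fun i => ρ ^ (2 * (i + 1)) * s⁻¹) (b := fun _ => -1)
      (summable_pow_mul_succ_mul hn h0 h1 _) (by linarith [a2.2] : 0 < ρ - ρ ^ 2 * s⁻¹)
      fun i => (b i).2.2.1.1⟩

include h0 h1 hs hs1 in
theorem continuousOn_imageSeries {e : E} (hn : n ≠ 0) (he : ‖e‖ = 1) :
    ContinuousOn (imageSeries n ρ s e) {x : E | ρ ≤ ‖x‖ ∧ ‖x‖ ≤ 1} := by
  have b := fun (x : E) (hx : x ∈ {x : E | ρ ≤ ‖x‖ ∧ ‖x‖ ≤ 1}) =>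
    image_bound h0 h1 hs hs1 he hx.1 hx.2
  have a2 := pow_two_mul_succ_div_le h0 h1 hs 0
  exact (((continuousOn_chargeSeries (summable_pow_mul hn h0 h1) (by linarith : 0 < 1 - s)
    fun i x hx => (b x hx i).1.1).sub
    (continuousOn_chargeSeries (summable_pow_mul_succ_mul hn h0 h1 _) (by linarith : 0 < 1 - ρ)
    fun i x hx => (b x hx i).2.1.1)).add
    (continuousOn_chargeSeries (summable_pow_mul_succ_mul hn h0 h1 _)
    (by linarith [a2.2] : 0 < ρ - ρ ^ 2 * s⁻¹) fun i x hx => (b x hx i).2.2.1.1)).sub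
    (continuousOn_chargeSeries (summable_pow_mul_succ hn h0 h1) (by nlinarith : 0 < ρ - ρ ^ 2)
    fun i x hx => (b x hx i).2.2.2.1)

include h0 h1 hs hs1 in
theorem harmonicOnNhd_imageSeries [FiniteDimensional ℝ E] (hE : Module.finrank ℝ E = n + 2)
    {e : E} (hn : n ≠ 0) (he : ‖e‖ = 1) {U : Set E} (hU : IsOpen U)
    (hUs : U ⊆ {x : E | ρ ≤ ‖x‖ ∧ ‖x‖ ≤ 1}) :
    InnerProductSpace.HarmonicOnNhd (imageSeries n ρ s e) U := by
  have hs0 : 0 < s := h0.trans hs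
  have b := fun (x : E) (hx : x ∈ U) =>
    image_bound h0 h1 hs hs1 he (hUs hx).1 (hUs hx).2
  have a1 := fun i => pow_two_mul_le h0 h1 hs0 i
  have a2 := fun i => pow_two_mul_succ_div_le h0 h1 hs i
  refine (((harmonicOnNhd_chargeSeries hE (summable_pow_mul hn h0 h1) (fun i => ?_) hU
    (by linarith : 0 < 1 - s) fun i x hx => (b x hx i).1).sub
    (harmonicOnNhd_chargeSeries hE (summable_pow_mul_succ_mul hn h0 h1 _) (fun i => ?_) hU
    (by linarith : 0 < 1 - ρ) fun i x hx => (b x hx i).2.1)).add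
    (harmonicOnNhd_chargeSeries hE (summable_pow_mul_succ_mul hn h0 h1 _) (fun i => ?_) hU
    (by linarith [(a2 0).2] : 0 < ρ - ρ ^ 2 * s⁻¹) fun i x hx => (b x hx i).2.2.1)).sub
    (harmonicOnNhd_chargeSeries hE (summable_pow_mul_succ hn h0 h1) (fun i => ?_) hU
    (by nlinarith : 0 < ρ - ρ ^ 2) fun i x hx => (b x hx i).2.2.2)
  · rw [abs_neg, abs_of_nonneg (by positivity)]
    linarith [a1 i]
  · rw [abs_neg, abs_of_nonneg (by positivity)]
    linarith [a2 i]
  · simp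
  · simp

include h0 h1 hs hs1 in
-- On the unit sphere families 2 and 3 cancel, and family 4 cancels family 1 except for its term `i
-- = 0`, which equals the kernel centred at the pole.
theorem imageSeries_outer {e x : E} (hn : n ≠ 0) (he : ‖e‖ = 1) (hx : ‖x‖ = 1) :
    imageSeries n ρ s e x = (‖x - s • e‖ ^ n)⁻¹ := by
  have hs0 : 0 < s := h0.trans hs
  have hsum := (summable_image h0 h1 hs hs1 (n := n) hn he (by rw [hx]; exact h1.le) hx.le).1
  have e23 : chargeSeries n (fun i => ρ ^ (n * (i + 1)) * (s ^ n)⁻¹) (fun _ => 1)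
      (fun i => -(ρ ^ (2 * (i + 1)) * s⁻¹)) e x =
      chargeSeries n (fun i => ρ ^ (n * (i + 1)) * (s ^ n)⁻¹) (fun i => ρ ^ (2 * (i + 1)) * s⁻¹)
      (fun _ => -1) e x := by
    refine tsum_congr fun i => ?_
    beta_reduce
    rw [norm_comb_eq (x := x) he (zero_le_one) (a := 1) (b := -(ρ ^ (2 * (i + 1)) * s⁻¹))
      (a' := ρ ^ (2 * (i + 1)) * s⁻¹) (b' := -1) (by rw [hx]; ring) (by ring), one_mul]
  have e4 : chargeSeries n (fun i => ρ ^ (n * (i + 1))) (fun i => ρ ^ (2 * (i + 1)) * s)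
      (fun _ => -1) e x = ∑' i : ℕ, ρ ^ (n * (i + 1)) *
        (‖(1 : ℝ) • e + (-(ρ ^ (2 * (i + 1)) * s)) • x‖ ^ n)⁻¹ := by
    refine tsum_congr fun i => ?_
    beta_reduce
    rw [norm_comb_eq (x := x) he (zero_le_one) (a := 1) (b := -(ρ ^ (2 * (i + 1)) * s))
      (a' := ρ ^ (2 * (i + 1)) * s) (b' := -1) (by rw [hx]; ring) (by ring), one_mul]
  have e5 : ‖x - s • e‖ = ‖(1 : ℝ) • e + (-(ρ ^ (2 * 0) * s)) • x‖ := by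
    rw [show x - s • e = (-s) • e + (1 : ℝ) • x by rw [one_smul, neg_smul]; abel,
      norm_comb_eq (x := x) he (zero_le_one) (a := 1) (b := -(ρ ^ (2 * 0) * s))
      (a' := -s) (b' := 1) (by rw [hx]; ring) (by ring), one_mul]
  rw [imageSeries, e23, e4, chargeSeries, hsum.tsum_eq_zero_add, e5]
  simp

include h0 h1 hs hs1 in
-- On the inner sphere families 1 and 4 cancel, and family 2 cancels family 3 except for its term `i
-- = 0`, which again is the kernel centred at the pole.
theorem imageSeries_inner {e x : E} (hn : n ≠ 0) (he : ‖e‖ = 1) (hx : ‖x‖ = ρ) :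
    imageSeries n ρ s e x = (‖x - s • e‖ ^ n)⁻¹ := by
  have hs0 : 0 < s := h0.trans hs
  have hsum := (summable_image h0 h1 hs hs1 (n := n) hn he hx.ge (by rw [hx]; exact h1.le)).2
  have e14 : chargeSeries n (fun i => ρ ^ (n * i)) (fun _ => 1) (fun i => -(ρ ^ (2 * i) * s)) e x =
      chargeSeries n (fun i => ρ ^ (n * (i + 1))) (fun i => ρ ^ (2 * (i + 1)) * s)
      (fun _ => -1) e x := by
    refine tsum_congr fun i => ?_
    beta_reduce
    rw [norm_comb_eq (x := x) he h0.le (a := 1) (b := -(ρ ^ (2 * i) * s))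
      (a' := ρ ^ (2 * (i + 1)) * s) (b' := -1) (by rw [hx]; ring) (by ring), mul_pow, mul_inv,
      mul_add n i 1, pow_add, mul_one]
    field_simp
  have e2 : chargeSeries n (fun i => ρ ^ (n * (i + 1)) * (s ^ n)⁻¹) (fun _ => 1)
      (fun i => -(ρ ^ (2 * (i + 1)) * s⁻¹)) e x =
      ∑' i : ℕ, ρ ^ (n * (i + 1 + 1)) * (s ^ n)⁻¹ *
      (‖(ρ ^ (2 * (i + 1 + 1)) * s⁻¹) • e + (-1 : ℝ) • x‖ ^ n)⁻¹ := by
    refine tsum_congr fun i => ?_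
    beta_reduce
    rw [norm_comb_eq (x := x) he h0.le (a := 1) (b := -(ρ ^ (2 * (i + 1)) * s⁻¹))
      (a' := ρ ^ (2 * (i + 1 + 1)) * s⁻¹) (b' := -1) (by rw [hx]; ring) (by ring), mul_pow, mul_inv,
      mul_add n (i + 1) 1, pow_add, mul_one]
    field_simp
  have e5 : (‖x - s • e‖ ^ n)⁻¹ = ρ ^ (n * (0 + 1)) * (s ^ n)⁻¹ *
      (‖(ρ ^ (2 * (0 + 1)) * s⁻¹) • e + (-1 : ℝ) • x‖ ^ n)⁻¹ := by
    rw [show x - s • e = (-s) • e + (1 : ℝ) • x by rw [one_smul, neg_smul]; abel,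
      norm_comb_eq (x := x) he (by positivity : 0 ≤ ρ * s⁻¹) (a := -s) (b := 1)
      (a' := ρ ^ (2 * (0 + 1)) * s⁻¹) (b' := -1) (by rw [hx]; field_simp; ring)
      (by field_simp), mul_pow, mul_pow]
    simp only [zero_add, mul_one, inv_pow]
    field_simp
  rw [imageSeries, e14, e2, e5]
  unfold chargeSeries
  rw [hsum.tsum_eq_zero_add]
  ring

end Bounds

end ImageSeries

/-! ### The regular part of the annulus -/

theorem isOpen_annulus (N : ℕ) (ρ : ℝ) : IsOpen (annulus N ρ) :=
  (isOpen_lt continuous_const continuous_norm).inter (isOpen_lt continuous_norm continuous_const)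

theorem closure_annulus_subset (N : ℕ) (ρ : ℝ) :
    closure (annulus N ρ) ⊆ {x | ρ ≤ ‖x‖ ∧ ‖x‖ ≤ 1} :=
  closure_minimal (fun _ hx => ⟨hx.1.le, hx.2.le⟩)
    ((isClosed_le continuous_const continuous_norm).inter
      (isClosed_le continuous_norm continuous_const))

theorem norm_of_mem_frontier_annulus {N : ℕ} {ρ : ℝ} {x : EuclideanSpace ℝ (Fin N)}
    (hx : x ∈ frontier (annulus N ρ)) : ‖x‖ = ρ ∨ ‖x‖ = 1 := by
  rw [(isOpen_annulus N ρ).frontier_eq] at hx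
  obtain ⟨h1, h2⟩ := closure_annulus_subset N ρ hx.1
  by_contra! h
  exact hx.2 ⟨lt_of_le_of_ne h1 h.1.symm, lt_of_le_of_ne h2 h.2⟩

theorem isBounded_annulus (N : ℕ) (ρ : ℝ) : Bornology.IsBounded (annulus N ρ) :=
  (Metric.isBounded_ball (x := 0) (r := 1)).subset fun x hx => by simpa using hx.2

theorem sphereArea_pos (n : ℕ) : 0 < sphereArea (n + 2) := by
  rw [sphereArea, MeasureTheory.Measure.toSphere_real_apply_univ]
  refine mul_pos (by simp; positivity) ?_
  exact ENNReal.toReal_pos (Metric.measure_ball_pos _ _ one_pos).ne' Metric.isBounded_ball.measure_lt_top.ne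

theorem fundamentalSolution_eq (n : ℕ) (z : EuclideanSpace ℝ (Fin (n + 2))) :
    fundamentalSolution (n + 2) z = (sphereArea (n + 2) * n)⁻¹ * (‖z‖ ^ n)⁻¹ := by
  rw [fundamentalSolution, Nat.add_sub_cancel, one_div, mul_inv]
  push_cast
  rw [add_sub_cancel_right]

section Annulus

variable {n : ℕ} {ρ : ℝ}

theorem isRegularPart_imageSeries (hn : n ≠ 0) (h0 : 0 < ρ) (h1 : ρ < 1)
    {y : EuclideanSpace ℝ (Fin (n + 2))} (hy : y ∈ annulus (n + 2) ρ) :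
    IsRegularPart (annulus (n + 2) ρ) y
      ((sphereArea (n + 2) * n)⁻¹ • imageSeries n ρ ‖y‖ (‖y‖⁻¹ • y)) := by
  have hy0 : ‖y‖ ≠ 0 := (h0.trans hy.1).ne'
  have he : ‖‖y‖⁻¹ • y‖ = 1 := by
    rw [norm_smul, norm_inv, norm_norm, inv_mul_cancel₀ hy0]
  have hye : ‖y‖ • (‖y‖⁻¹ • y) = y := by rw [smul_smul, mul_inv_cancel₀ hy0, one_smul]
  refine ⟨(harmonicOnNhd_imageSeries h0 h1 hy.1 hy.2 (by simp) hn he (isOpen_annulus _ _)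
    (subset_closure.trans (closure_annulus_subset _ _))).const_smul,
    ((continuousOn_imageSeries h0 h1 hy.1 hy.2 hn he).mono
      (closure_annulus_subset _ _)).const_smul _, fun x hx => ?_⟩
  rw [fundamentalSolution_eq, Pi.smul_apply, smul_eq_mul]
  congr 1
  rcases norm_of_mem_frontier_annulus hx with h | h
  · rw [imageSeries_inner h0 h1 hy.1 hy.2 hn he h, hye]
  · rw [imageSeries_outer h0 h1 hy.1 hy.2 hn he h, hye]

/-- The image series shows that the choice in `regularPart` does solve the Dirichlet problem; the
maximum principle then identifies the two solutions. -/
theorem regularPart_annulus (hn : n ≠ 0) (h0 : 0 < ρ) (h1 : ρ < 1)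
    {x y : EuclideanSpace ℝ (Fin (n + 2))} (hx : x ∈ annulus (n + 2) ρ)
    (hy : y ∈ annulus (n + 2) ρ) :
    regularPart (annulus (n + 2) ρ) x y =
      (sphereArea (n + 2) * n)⁻¹ * imageSeries n ρ ‖y‖ (‖y‖⁻¹ • y) x := by
  have h := isRegularPart_imageSeries hn h0 h1 hy
  have h' : IsRegularPart (annulus (n + 2) ρ) y
    (Classical.epsilon (IsRegularPart (annulus (n + 2) ρ) y)) := Classical.epsilon_spec ⟨_, h⟩
  exact h'.1.eqOn_of_frontier (isOpen_annulus _ _) (isBounded_annulus _ _) h.1 h'.2.1 h.2.1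
    (fun z hz => (h'.2.2 z hz).trans (h.2.2 z hz).symm) (subset_closure hx)

end Annulus

/-! ### Zonal expansion on a sphere -/

theorem HasSum.congr_of_eq {f g : ℕ → ℝ} {a b : ℝ} (h : HasSum f a) (hf : ∀ m, g m = f m)
    (ha : b = a) : HasSum g b := by
  rw [ha, show g = f from funext hf]
  exact h

/-- The kernel `zⁿ (1 - 2 z² cos θ + z⁴)^{-n/2}`. -/
noncomputable def zonalKernel (n : ℕ) (θ z : ℝ) : ℝ :=
  z ^ n * (1 - 2 * Real.cos θ * z ^ 2 + (z ^ 2) ^ 2) ^ (-((n : ℝ) / 2))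

theorem abs_gegenbauerCos_le {l : ℝ} (hl : 0 < l) (m : ℕ) (θ : ℝ) :
    |gegenbauerCos l m θ| ≤ gegenbauerCos l m 0 := by
  unfold gegenbauerCos
  refine (Finset.abs_sum_le_sum_abs _ _).trans (Finset.sum_le_sum fun p _ => ?_)
  have h := (mul_pos (multichoose_real_pos hl p.1) (multichoose_real_pos hl p.2)).le
  rw [abs_mul, abs_of_nonneg h]
  refine mul_le_mul_of_nonneg_left ?_ h
  simpa using Real.abs_cos_le_one _

theorem hasSum_zonalKernel {n : ℕ} (hn : n ≠ 0) (θ : ℝ) {z : ℝ} (hz0 : 0 ≤ z) (hz : z < 1) :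
    HasSum (fun m => gegenbauerCos ((n : ℝ) / 2) m θ * z ^ (2 * m + n)) (zonalKernel n θ z) := by
  have hz2 : |z ^ 2| < 1 := by
    rw [abs_of_nonneg (by positivity)]
    exact pow_lt_one₀ hz0 hz two_ne_zero
  have h := (hasSum_gegenbauerCos (by positivity : 0 < (n : ℝ) / 2) θ hz2).mul_left (z ^ n)
  exact h.congr_of_eq (fun m => by ring) rfl

/-- Each kernel is expanded in `m`, and the exchanged sum over `i` is geometric. The exchange is
justified by `(ρ^i)^q ≤ ρ^i` and by the domination of Gegenbauer values by those at angle `0`. -/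
theorem hasSum_tsum_zonalKernel {n : ℕ} (hn : n ≠ 0) (θ : ℝ) {ρ a : ℝ} (h0 : 0 < ρ) (h1 : ρ < 1)
    (ha0 : 0 < a) (ha : a < 1) :
    HasSum (fun m => gegenbauerCos ((n : ℝ) / 2) m θ *
      (a ^ (2 * m + n) / (1 - ρ ^ (2 * m + n)))) (∑' i : ℕ, zonalKernel n θ (ρ ^ i * a)) := by
  have hl : 0 < (n : ℝ) / 2 := by positivity
  let F : ℕ × ℕ → ℝ := fun p => gegenbauerCos ((n : ℝ) / 2) p.2 θ * (ρ ^ p.1 * a) ^ (2 * p.2 + n)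
  have hF : Summable F := by
    have s1 := (hasSum_zonalKernel hn 0 ha0.le ha).summable
    have s2 := summable_geometric_of_lt_one h0.le h1
    have hc : ∀ m, 0 ≤ gegenbauerCos ((n : ℝ) / 2) m 0 := fun m =>
      (abs_nonneg _).trans (abs_gegenbauerCos_le hl m 0)
    have s3 := s2.mul_of_nonneg s1 (fun i => by simp; positivity)
      (fun m => mul_nonneg (hc m) (by positivity))
    refine Summable.of_norm_bounded s3 fun p => ?_
    have hq : 2 * p.2 + n ≠ 0 := by omega
    have h2 : (ρ ^ p.1) ^ (2 * p.2 + n) ≤ ρ ^ p.1 :=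
      pow_le_of_le_one (by positivity) (pow_le_one₀ h0.le h1.le) hq
    simp only [F]
    rw [norm_mul, Real.norm_eq_abs, Real.norm_of_nonneg (by positivity), mul_pow]
    calc |gegenbauerCos ((n : ℝ) / 2) p.2 θ| * ((ρ ^ p.1) ^ (2 * p.2 + n) * a ^ (2 * p.2 + n))
        ≤ gegenbauerCos ((n : ℝ) / 2) p.2 0 * (ρ ^ p.1 * a ^ (2 * p.2 + n)) := by
          have := hc p.2
          gcongr
          exact abs_gegenbauerCos_le hl _ _
      _ = _ := by ring
  have hrow : ∀ i, HasSum (fun m => F (i, m)) (zonalKernel n θ (ρ ^ i * a)) := fun i => by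
    refine hasSum_zonalKernel hn θ (by positivity) ?_
    have : ρ ^ i ≤ 1 := pow_le_one₀ h0.le h1.le
    nlinarith
  have hcol : ∀ m, HasSum (fun i => F (i, m)) (gegenbauerCos ((n : ℝ) / 2) m θ *
      (a ^ (2 * m + n) / (1 - ρ ^ (2 * m + n)))) := fun m => by
    have hr : ρ ^ (2 * m + n) < 1 := pow_lt_one₀ h0.le h1 (by omega)
    have h := (hasSum_geometric_of_lt_one (by positivity) hr).mul_left
      (gegenbauerCos ((n : ℝ) / 2) m θ * a ^ (2 * m + n))
    refine h.congr_of_eq (fun i => ?_) (by rw [div_eq_mul_inv]; ring)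
    simp only [F]
    rw [mul_pow, ← pow_mul, ← pow_mul, mul_comm i]
    ring
  have e := hF.hasSum.prod_fiberwise hrow
  rw [e.tsum_eq]
  exact ((Equiv.prodComm ℕ ℕ).hasSum_iff.2 hF.hasSum).prod_fiberwise hcol

/-- The radial factor of degree `m` in the expansion of the regular part on a sphere of
radius `r`. -/
noncomputable def radialFactor (n m : ℕ) (ρ r : ℝ) : ℝ :=
  (r ^ (2 * m + n) + (ρ / r) ^ (2 * m + n) - 2 * ρ ^ (2 * m + n)) / (1 - ρ ^ (2 * m + n))

/-- Factoring `d²` out of the squared distance leaves the Gegenbauer generating function at `z²`;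
`hw` matches the remaining powers. -/
theorem charge_eq_kernel {E : Type*} [NormedAddCommGroup E] [InnerProductSpace ℝ E] {n : ℕ}
    {e x : E} {r θ c d z w a b : ℝ} (he : ‖e‖ = 1) (hx : ‖x‖ = r) (hd : 0 < d)
    (hi : inner ℝ e x = r * Real.cos θ) (hw : c * w = d ^ n * z ^ n)
    (hab : a ^ 2 + b ^ 2 * r ^ 2 = d ^ 2 * (1 + (z ^ 2) ^ 2)) (hab' : a * b * r = -(d ^ 2 * z ^ 2)) :
    c * (w * (‖a • e + b • x‖ ^ n)⁻¹) = zonalKernel n θ z := by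
  have h : ‖a • e + b • x‖ ^ 2 = d ^ 2 * (1 - 2 * Real.cos θ * z ^ 2 + (z ^ 2) ^ 2) := by
    rw [norm_sq_comb he, hi, hx]
    linear_combination hab + 2 * Real.cos θ * hab'
  have hp : 0 ≤ 1 - 2 * Real.cos θ * z ^ 2 + (z ^ 2) ^ 2 := by
    have h1 := Real.cos_le_one θ
    nlinarith [sq_nonneg (1 - z ^ 2), sq_nonneg z]
  rw [zonalKernel, ← mul_assoc, hw, ← rpow_neg_half_sq (norm_nonneg _), h,
    Real.mul_rpow (by positivity) hp, rpow_neg_half_sq hd.le]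
  field_simp

/-- The four families become kernels at `ρ^i r`, `ρ^{i+1}`, `ρ^i (ρ/r)` and `ρ^{i+1}`. The second
and fourth coincide, whence the `-2 ρ^q` in the radial factor. -/
theorem hasSum_imageSeries {E : Type*} [NormedAddCommGroup E] [InnerProductSpace ℝ E] {n : ℕ}
    (hn : n ≠ 0) {ρ r θ : ℝ} (h0 : 0 < ρ) (h1 : ρ < 1) (hr : ρ < r) (hr1 : r < 1) {e x : E}
    (he : ‖e‖ = 1) (hx : ‖x‖ = r) (hi : inner ℝ e x = r * Real.cos θ) :
    HasSum (fun m => gegenbauerCos ((n : ℝ) / 2) m θ * radialFactor n m ρ r)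
      (r ^ n * imageSeries n ρ r e x) := by
  have hr0 : 0 < r := h0.trans hr
  have hq : ρ / r < 1 := (div_lt_one hr0).2 hr
  have k1 := hasSum_tsum_zonalKernel hn θ h0 h1 hr0 hr1
  have k2 := hasSum_tsum_zonalKernel hn θ h0 h1 h0 h1
  have k3 := hasSum_tsum_zonalKernel hn θ h0 h1 (div_pos h0 hr0) hq
  have h := ((k1.sub k2).add k3).sub k2
  have e1 : r ^ n * chargeSeries n (fun i => ρ ^ (n * i)) (fun _ => 1)
      (fun i => -(ρ ^ (2 * i) * r)) e x = ∑' i : ℕ, zonalKernel n θ (ρ ^ i * r) := by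
    rw [chargeSeries, ← tsum_mul_left]
    exact tsum_congr fun i => charge_eq_kernel he hx one_pos hi (by ring) (by ring) (by ring)
  have e2 : r ^ n * chargeSeries n (fun i => ρ ^ (n * (i + 1)) * (r ^ n)⁻¹) (fun _ => 1)
      (fun i => -(ρ ^ (2 * (i + 1)) * r⁻¹)) e x = ∑' i : ℕ, zonalKernel n θ (ρ ^ i * ρ) := by
    rw [chargeSeries, ← tsum_mul_left]
    exact tsum_congr fun i => charge_eq_kernel he hx one_pos hi (by field_simp; ring)
      (by field_simp; ring) (by field_simp; ring)
  have e3 : r ^ n * chargeSeries n (fun i => ρ ^ (n * (i + 1)) * (r ^ n)⁻¹)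
      (fun i => ρ ^ (2 * (i + 1)) * r⁻¹) (fun _ => -1) e x =
      ∑' i : ℕ, zonalKernel n θ (ρ ^ i * (ρ / r)) := by
    rw [chargeSeries, ← tsum_mul_left]
    refine tsum_congr fun i => charge_eq_kernel he hx hr0 hi ?_ (by field_simp; ring)
      (by field_simp; ring)
    rw [mul_pow, div_pow]
    field_simp
    ring
  have e4 : r ^ n * chargeSeries n (fun i => ρ ^ (n * (i + 1))) (fun i => ρ ^ (2 * (i + 1)) * r)
      (fun _ => -1) e x = ∑' i : ℕ, zonalKernel n θ (ρ ^ i * ρ) := by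
    rw [chargeSeries, ← tsum_mul_left]
    exact tsum_congr fun i => charge_eq_kernel he hx hr0 hi (by ring) (by ring) (by ring)
  refine h.congr_of_eq (fun m => ?_) ?_
  · unfold radialFactor
    ring
  · rw [imageSeries, mul_sub, mul_add, mul_sub, e1, e2, e3, e4]

/-! ### The peaks and the expansion of `Λ₁` -/

theorem peak_inner (n k i j : ℕ) (r : ℝ) :
    inner ℝ (peak (n + 2) k i r) (peak (n + 2) k j r) =
      r ^ 2 * Real.cos (2 * Real.pi * ((j : ℝ) - i) / k) := by
  have e : 2 * Real.pi * ((j : ℝ) - i) / k =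
      2 * Real.pi * ((j : ℝ) - 1) / k - 2 * Real.pi * ((i : ℝ) - 1) / k := by ring
  rw [e, Real.cos_sub]
  simp [peak, PiLp.inner_apply, Fin.sum_univ_succ]
  ring

theorem norm_peak (n k i : ℕ) {r : ℝ} (hr : 0 ≤ r) : ‖peak (n + 2) k i r‖ = r := by
  rw [← sq_eq_sq₀ (norm_nonneg _) hr, ← real_inner_self_eq_norm_sq, peak_inner]
  simp

theorem norm_peak_sub (n k j : ℕ) {r : ℝ} (hr : 0 ≤ r) :
    ‖peak (n + 2) k 1 r - peak (n + 2) k (j + 1) r‖ = r * |2 * Real.sin (Real.pi * j / k)| := by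
  rw [← sq_eq_sq₀ (norm_nonneg _) (by positivity), norm_sub_sq_real, norm_peak _ _ _ hr,
    norm_peak _ _ _ hr, peak_inner, mul_pow, sq_abs, mul_pow, Real.sin_sq_eq_half_sub]
  have e : 2 * Real.pi * (((j + 1 : ℕ) : ℝ) - (1 : ℕ)) / k = 2 * (Real.pi * j / k) := by
    push_cast
    ring
  rw [e]
  ring

theorem sin_peak_pos {k j : ℕ} (hj : j ∈ Ico 1 k) : 0 < Real.sin (Real.pi * j / k) := by
  obtain ⟨h1, h2⟩ := Finset.mem_Ico.1 hj
  have hj0 : (0 : ℝ) < j := by exact_mod_cast h1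
  have hjk : (j : ℝ) < k := by exact_mod_cast h2
  refine Real.sin_pos_of_pos_of_lt_pi
    (div_pos (mul_pos Real.pi_pos hj0) (hj0.trans hjk)) ?_
  rw [div_lt_iff₀ (hj0.trans hjk)]
  exact mul_lt_mul_of_pos_left hjk Real.pi_pos

/-- The Robin term and the regular parts inside the Green functions form one sum over all `k`
angles. The fundamental solutions, multiplied by `ω n r^n`, add up to `peakConst`, since the
distances between peaks are proportional to `r`. -/
theorem hasSum_Lambda1 {n k : ℕ} (hn : n ≠ 0) (hk : k ≠ 0) {ρ r : ℝ} (h0 : 0 < ρ)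
    (hr : ρ < r) (hr1 : r < 1) :
    HasSum (fun m => orbitCoeff ((n : ℝ) / 2) k m * radialFactor n m ρ r)
      (sphereArea (n + 2) * n * r ^ n * Lambda1 (n + 2) k ρ r + peakConst (n + 2) k) := by
  have h1 : ρ < 1 := hr.trans hr1
  have hr0 : 0 < r := h0.trans hr
  have hω := sphereArea_pos n
  have hn0 : (0 : ℝ) < n := Nat.cast_pos.2 (Nat.pos_of_ne_zero hn)
  have hmem : ∀ j, peak (n + 2) k j r ∈ annulus (n + 2) ρ := fun j => by
    constructor <;> rw [norm_peak _ _ _ hr0.le] <;> assumption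
  have hH : ∀ j : ℕ, HasSum
      (fun m => gegenbauerCos ((n : ℝ) / 2) m (2 * Real.pi * j / k) * radialFactor n m ρ r)
      (sphereArea (n + 2) * n * r ^ n *
        regularPart (annulus (n + 2) ρ) (peak (n + 2) k 1 r) (peak (n + 2) k (j + 1) r)) := by
    intro j
    have hx := norm_peak n k 1 hr0.le
    have hy := norm_peak n k (j + 1) hr0.le
    have h := hasSum_imageSeries hn h0 h1 hr hr1 (e := r⁻¹ • peak (n + 2) k (j + 1) r)
      (θ := 2 * Real.pi * j / k)
      (by rw [norm_smul, hy, norm_inv, Real.norm_of_nonneg hr0.le, inv_mul_cancel₀ hr0.ne']) hx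
      (by
        rw [inner_smul_left, real_inner_comm, peak_inner]
        simp
        field_simp)
    refine h.congr_of_eq (fun m => rfl) ?_
    rw [regularPart_annulus hn h0 h1 (hmem _) (hmem _), hy]
    field_simp
  have hsum := hasSum_sum (s := range k) fun j _ => hH j
  refine hsum.congr_of_eq (fun m => by rw [orbitCoeff, Finset.sum_mul]) ?_
  have hg : ∀ j ∈ Ico 1 k, sphereArea (n + 2) * n * r ^ n * fundamentalSolution (n + 2)
      (peak (n + 2) k 1 r - peak (n + 2) k (j + 1) r) =
      1 / (2 * Real.sin (Real.pi * j / k)) ^ n := by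
    intro j hj
    have hs := sin_peak_pos hj
    rw [fundamentalSolution_eq, norm_peak_sub _ _ _ hr0.le, abs_of_pos (mul_pos two_pos hs), mul_pow]
    field_simp
  rw [← Finset.mul_sum, Finset.sum_range_eq_add_Ico _ (Nat.pos_of_ne_zero hk), Lambda1, peakConst,
    Nat.add_sub_cancel, ← Finset.sum_congr rfl hg, ← Finset.mul_sum, robinFunction]
  simp only [greenFunction, Finset.sum_sub_distrib]
  ring

/-! ### The orbit series and the threshold series -/

/-- The power series whose coefficients are the orbit sums of the Gegenbauer polynomials. -/
noncomputable def orbitSeries (n k : ℕ) (z : ℝ) : ℝ :=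
  ∑' m, orbitCoeff ((n : ℝ) / 2) k m * z ^ (2 * m + n)

/-- The series whose value at `√ρ` decides the sign of the minimum of `Λ₁`. -/
noncomputable def thresholdSeries (n k : ℕ) (σ : ℝ) : ℝ :=
  ∑' m, orbitCoeff ((n : ℝ) / 2) k m * (2 * σ ^ (2 * m + n) / (1 + σ ^ (2 * m + n)))

section OrbitSeries

variable {n k : ℕ} (hn : n ≠ 0) (hk : k ≠ 0)

include hn hk in
theorem orbitCoeff_half_nonneg (m : ℕ) : 0 ≤ orbitCoeff ((n : ℝ) / 2) k m :=
  orbitCoeff_nonneg (by positivity) hk m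

theorem one_sub_sq_sq_le (θ z : ℝ) :
    (1 - z ^ 2) ^ 2 ≤ 1 - 2 * Real.cos θ * z ^ 2 + (z ^ 2) ^ 2 := by
  nlinarith [Real.cos_le_one θ, sq_nonneg z]

include hn in
theorem hasSum_orbitSeries (k : ℕ) {z : ℝ} (hz0 : 0 ≤ z) (hz : z < 1) :
    HasSum (fun m => orbitCoeff ((n : ℝ) / 2) k m * z ^ (2 * m + n)) (orbitSeries n k z) ∧
      orbitSeries n k z = ∑ j ∈ range k, zonalKernel n (2 * Real.pi * j / k) z := by
  have h := hasSum_sum (s := range k) fun j _ => hasSum_zonalKernel hn (2 * Real.pi * j / k) hz0 hz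
  simp only [← Finset.sum_mul] at h
  exact ⟨h.summable.hasSum, h.tsum_eq⟩

theorem zonalKernel_nonneg (n : ℕ) (θ : ℝ) {z : ℝ} (hz0 : 0 ≤ z) : 0 ≤ zonalKernel n θ z :=
  mul_nonneg (by positivity) (Real.rpow_nonneg ((sq_nonneg _).trans (one_sub_sq_sq_le θ z)) _)

theorem zonalKernel_zero (n : ℕ) {z : ℝ} (hz0 : 0 ≤ z) (hz : z < 1) :
    zonalKernel n 0 z = (z / (1 - z ^ 2)) ^ n := by
  rw [zonalKernel, Real.cos_zero,
    show 1 - 2 * 1 * z ^ 2 + (z ^ 2) ^ 2 = (1 - z ^ 2) ^ 2 by ring,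
    rpow_neg_half_sq (by nlinarith), div_pow, div_eq_mul_inv]

theorem zonalKernel_le (n : ℕ) (θ : ℝ) {z : ℝ} (hz0 : 0 ≤ z) (hz : z < 1) :
    zonalKernel n θ z ≤ (z / (1 - z ^ 2)) ^ n := by
  have h1 : 0 < (1 - z ^ 2) := by nlinarith
  rw [← zonalKernel_zero n hz0 hz, zonalKernel, zonalKernel, Real.cos_zero,
    show 1 - 2 * 1 * z ^ 2 + (z ^ 2) ^ 2 = (1 - z ^ 2) ^ 2 by ring]
  refine mul_le_mul_of_nonneg_left ?_ (by positivity)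
  exact Real.rpow_le_rpow_of_nonpos (by positivity) (one_sub_sq_sq_le θ z)
    (neg_nonpos.2 (by positivity))

include hn in
-- Each of the `k` kernels is at most the one at angle `0`.
theorem orbitSeries_le (k : ℕ) {z : ℝ} (hz0 : 0 ≤ z) (hz : z < 1) :
    orbitSeries n k z ≤ k * (z / (1 - z ^ 2)) ^ n := by
  rw [(hasSum_orbitSeries hn k hz0 hz).2]
  refine (Finset.sum_le_sum fun j _ => zonalKernel_le n _ hz0 hz).trans ?_
  simp

include hn hk in
-- Only the kernel with `j = 0` is kept; the others are nonnegative.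
theorem le_orbitSeries {z : ℝ} (hz0 : 0 ≤ z) (hz : z < 1) :
    (z / (1 - z ^ 2)) ^ n ≤ orbitSeries n k z := by
  rw [(hasSum_orbitSeries hn k hz0 hz).2, ← zonalKernel_zero n hz0 hz]
  have h := Finset.single_le_sum (f := fun j : ℕ => zonalKernel n (2 * Real.pi * j / k) z)
    (fun j _ => zonalKernel_nonneg n _ hz0) (Finset.mem_range.2 (Nat.pos_of_ne_zero hk))
  simpa using h

include hn hk in
theorem exists_forall_le_orbitSeries (M : ℝ) :
    ∃ b ∈ Set.Ioo (0 : ℝ) 1, ∀ z, b ≤ z → z < 1 → M ≤ orbitSeries n k z := by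
  set A : ℝ := |M| + 1 with hA
  have hA1 : 1 ≤ A := by linarith [abs_nonneg M]
  have hAi : A⁻¹ ≤ 1 := inv_le_one_of_one_le₀ hA1
  have hAp : 0 < A⁻¹ := by positivity
  -- For `z ≥ 1 - 1/(4A)` one has `1 - z² ≤ 2(1 - z) ≤ 1/(2A)` and `z ≥ 3/4`, so `z / (1 - z²) ≥ A`.
  refine ⟨1 - A⁻¹ / 4, ⟨by linarith, by linarith⟩, fun z hbz hz => ?_⟩
  have hz0 : 3 / 4 ≤ z := by linarith
  refine le_trans ?_ (le_orbitSeries hn hk (by linarith) hz)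
  have h1 : 0 < 1 - z ^ 2 := by nlinarith
  have h2 : 1 - z ^ 2 ≤ A⁻¹ / 2 := by nlinarith
  have h3 : A ≤ z / (1 - z ^ 2) := by
    rw [le_div_iff₀ h1]
    have : A * A⁻¹ = 1 := mul_inv_cancel₀ (by positivity)
    nlinarith
  calc M ≤ A := by linarith [le_abs_self M]
    _ ≤ z / (1 - z ^ 2) := h3
    _ ≤ (z / (1 - z ^ 2)) ^ n := le_self_pow₀ (hA1.trans h3) hn

theorem two_mul_div_one_add_mono {x y : ℝ} (hx : 0 ≤ x) (hxy : x < y) :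
    2 * x / (1 + x) < 2 * y / (1 + y) := by
  rw [div_lt_div_iff₀ (by linarith) (by linarith)]
  nlinarith

include hn hk in
theorem summable_thresholdSeries {σ : ℝ} (h0 : 0 ≤ σ) (h1 : σ < 1) :
    Summable fun m => orbitCoeff ((n : ℝ) / 2) k m *
      (2 * σ ^ (2 * m + n) / (1 + σ ^ (2 * m + n))) := by
  refine Summable.of_nonneg_of_le (fun m => ?_) (fun m => ?_)
    ((hasSum_orbitSeries hn k h0 h1).1.summable.mul_left 2)
  · have := orbitCoeff_half_nonneg hn hk m
    positivity
  · have hc := orbitCoeff_half_nonneg hn hk m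
    have hp : 0 ≤ σ ^ (2 * m + n) := by positivity
    have : 2 * σ ^ (2 * m + n) / (1 + σ ^ (2 * m + n)) ≤ 2 * σ ^ (2 * m + n) :=
      div_le_self (by positivity) (by linarith)
    nlinarith

include hn hk in
theorem strictMonoOn_thresholdSeries : StrictMonoOn (thresholdSeries n k) (Set.Ico 0 1) := by
  intro x hx y hy hxy
  have hlt : ∀ m, 2 * x ^ (2 * m + n) / (1 + x ^ (2 * m + n)) <
      2 * y ^ (2 * m + n) / (1 + y ^ (2 * m + n)) := fun m =>
    two_mul_div_one_add_mono (pow_nonneg hx.1 _) (pow_lt_pow_left₀ hxy hx.1 (by omega))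
  -- Some `c_m` may vanish; strictness comes from the term `m = 0`, where `c_0 = k`.
  refine (summable_thresholdSeries hn hk hx.1 hx.2).tsum_lt_tsum (i := 0) (fun m => ?_) ?_
    (summable_thresholdSeries hn hk hy.1 hy.2)
  · exact mul_le_mul_of_nonneg_left (hlt m).le (orbitCoeff_half_nonneg hn hk m)
  · refine mul_lt_mul_of_pos_left (hlt 0) ?_
    rw [orbitCoeff_zero]
    exact_mod_cast Nat.pos_of_ne_zero hk

include hn hk in
theorem continuousOn_thresholdSeries {b : ℝ} (hb0 : 0 ≤ b) (hb : b < 1) :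
    ContinuousOn (thresholdSeries n k) (Set.Icc 0 b) := by
  refine continuousOn_tsum (fun m => ?_)
    ((hasSum_orbitSeries hn k hb0 hb).1.summable.mul_left 2) fun m x hx => ?_
  · refine continuousOn_const.mul (ContinuousOn.div (by fun_prop) (by fun_prop) fun x hx => ?_)
    have := pow_nonneg hx.1 (2 * m + n)
    positivity
  · have hc := orbitCoeff_half_nonneg hn hk m
    have hp := pow_nonneg hx.1 (2 * m + n)
    have h1 : 2 * x ^ (2 * m + n) / (1 + x ^ (2 * m + n)) ≤ 2 * x ^ (2 * m + n) :=
      div_le_self (by positivity) (by linarith)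
    have h2 : x ^ (2 * m + n) ≤ b ^ (2 * m + n) := pow_le_pow_left₀ hx.1 hx.2 _
    rw [Real.norm_of_nonneg (by positivity)]
    calc _ ≤ orbitCoeff ((n : ℝ) / 2) k m * (2 * b ^ (2 * m + n)) := by
          refine mul_le_mul_of_nonneg_left ?_ hc
          linarith
      _ = _ := by ring

include hn in
theorem thresholdSeries_zero : thresholdSeries n k 0 = 0 := by
  simp [thresholdSeries, hn]

include hn hk in
-- Here `1 + σ^q ≤ 2`. The threshold series therefore inherits the blow-up at `1`.
theorem orbitSeries_le_thresholdSeries {σ : ℝ} (h0 : 0 ≤ σ) (h1 : σ < 1) :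
    orbitSeries n k σ ≤ thresholdSeries n k σ := by
  refine (hasSum_orbitSeries hn k h0 h1).1.summable.tsum_le_tsum (fun m => ?_)
    (summable_thresholdSeries hn hk h0 h1)
  refine mul_le_mul_of_nonneg_left ?_ (orbitCoeff_half_nonneg hn hk m)
  have hp := pow_nonneg h0 (2 * m + n)
  have hp1 : σ ^ (2 * m + n) ≤ 1 := pow_le_one₀ h0 h1.le
  rw [le_div_iff₀ (by linarith)]
  nlinarith

include hn hk in
theorem thresholdSeries_lt {σ : ℝ} (h0 : 0 < σ) (h1 : σ < 1) :
    thresholdSeries n k σ < 2 * orbitSeries n k σ := by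
  have hlt : ∀ m, 2 * σ ^ (2 * m + n) / (1 + σ ^ (2 * m + n)) < 2 * σ ^ (2 * m + n) := fun m =>
    div_lt_self (by positivity) (by linarith [pow_pos h0 (2 * m + n)])
  rw [orbitSeries, ← tsum_mul_left]
  refine (summable_thresholdSeries hn hk h0.le h1).tsum_lt_tsum (i := 0) (fun m => ?_) ?_
    ((hasSum_orbitSeries hn k h0.le h1).1.summable.mul_left 2)
  · have := mul_le_mul_of_nonneg_left (hlt m).le (orbitCoeff_half_nonneg hn hk m)
    linarith
  · have hc : 0 < orbitCoeff ((n : ℝ) / 2) k 0 := by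
      rw [orbitCoeff_zero]
      exact_mod_cast Nat.pos_of_ne_zero hk
    have := mul_lt_mul_of_pos_left (hlt 0) hc
    linarith

include hn hk in
theorem exists_thresholdSeries_eq {C : ℝ} (hC : 0 < C) :
    ∃ σ ∈ Set.Ioo (0 : ℝ) 1, thresholdSeries n k σ = C := by
  obtain ⟨b, hb, hbC⟩ := exists_forall_le_orbitSeries hn hk C
  have h1 := (hbC b le_rfl hb.2).trans (orbitSeries_le_thresholdSeries hn hk hb.1.le hb.2)
  obtain ⟨σ, hσ, hσC⟩ := intermediate_value_Icc hb.1.le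
    (continuousOn_thresholdSeries hn hk hb.1.le hb.2)
    ⟨by rw [thresholdSeries_zero hn]; exact hC.le, h1⟩
  refine ⟨σ, ⟨lt_of_le_of_ne hσ.1 ?_, hσ.2.trans_lt hb.2⟩, hσC⟩
  rintro rfl
  rw [thresholdSeries_zero hn] at hσC
  exact hC.ne hσC

end OrbitSeries

/-! ### Estimates for the radial factors -/

section RadialFactor

variable {n m : ℕ} {ρ r : ℝ}

theorem radialFactor_sqrt (hn : n ≠ 0) {σ : ℝ} (h0 : 0 < σ) (h1 : σ < 1) :
    radialFactor n m (σ ^ 2) σ = 2 * σ ^ (2 * m + n) / (1 + σ ^ (2 * m + n)) := by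
  have hq : σ ^ (2 * m + n) < 1 := pow_lt_one₀ h0.le h1 (by omega)
  have hp : 0 < σ ^ (2 * m + n) := by positivity
  rw [radialFactor, show σ ^ 2 / σ = σ by field_simp, ← pow_mul, mul_comm 2 (2 * m + n), pow_mul,
    div_eq_div_iff (by nlinarith) (by linarith)]
  ring

/-- AM-GM: `r^q` and `(ρ/r)^q` have the fixed product `ρ^q`. The minimizing radius `√ρ` is the same
for all `m`. -/
theorem le_radialFactor (hn : n ≠ 0) (h0 : 0 < ρ) (h1 : ρ < 1) (hr : 0 < r) {σ : ℝ}
    (hσ : 0 < σ) (hσρ : σ ^ 2 = ρ) :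
    2 * σ ^ (2 * m + n) / (1 + σ ^ (2 * m + n)) ≤ radialFactor n m ρ r := by
  have hσ1 : σ < 1 := by nlinarith
  rw [← radialFactor_sqrt hn hσ hσ1, hσρ]
  have hq : ρ ^ (2 * m + n) < 1 := pow_lt_one₀ h0.le h1 (by omega)
  refine div_le_div_of_nonneg_right ?_ (by linarith)
  have e : ρ / σ = σ := by rw [← hσρ]; field_simp
  rw [e]
  have hx : 0 < r ^ (2 * m + n) := by positivity
  have hy : 0 < (ρ / r) ^ (2 * m + n) := by positivity
  have hxy : r ^ (2 * m + n) * (ρ / r) ^ (2 * m + n) = (σ ^ (2 * m + n)) ^ 2 := by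
    rw [← mul_pow, mul_div_cancel₀ _ hr.ne', ← hσρ, ← pow_mul, ← pow_mul, mul_comm]
  have hs : 0 < σ ^ (2 * m + n) := by positivity
  have : 2 * σ ^ (2 * m + n) ≤ r ^ (2 * m + n) + (ρ / r) ^ (2 * m + n) := by
    refine le_of_sq_le_sq ?_ (by positivity)
    nlinarith [sq_nonneg (r ^ (2 * m + n) - (ρ / r) ^ (2 * m + n))]
  linarith

/-- Both powers are at least `ρ^q`, and the denominator is at most `1`. The two bounds control `r`
near `1` and `r` near `ρ` respectively. -/
theorem sub_le_radialFactor (hn : n ≠ 0) (h0 : 0 < ρ) (hr : ρ < r) (hr1 : r < 1) :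
    r ^ (2 * m + n) - ρ ^ (2 * m + n) ≤ radialFactor n m ρ r ∧
      (ρ / r) ^ (2 * m + n) - ρ ^ (2 * m + n) ≤ radialFactor n m ρ r := by
  have hr0 : 0 < r := h0.trans hr
  have hq : ρ ^ (2 * m + n) < 1 := pow_lt_one₀ h0.le (hr.trans hr1) (by omega)
  have hq0 : 0 < ρ ^ (2 * m + n) := by positivity
  have h1 : ρ ^ (2 * m + n) ≤ r ^ (2 * m + n) := by gcongr
  have h2 : ρ ^ (2 * m + n) ≤ (ρ / r) ^ (2 * m + n) := by
    gcongr
    exact le_div_self h0.le hr0 hr1.le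
  have hN : r ^ (2 * m + n) + (ρ / r) ^ (2 * m + n) - 2 * ρ ^ (2 * m + n) ≤ radialFactor n m ρ r :=
    le_div_self (by linarith) (by linarith) (by linarith)
  constructor <;> linarith

theorem radialFactor_le (hn : n ≠ 0) (h0 : 0 < ρ) (h1 : ρ < 1) {b : ℝ} (hr0 : 0 < r) (hr : r ≤ b)
    (hr' : ρ / r ≤ b) : radialFactor n m ρ r ≤ 2 * b ^ (2 * m + n) / (1 - ρ) := by
  have hq : ρ ^ (2 * m + n) ≤ ρ := pow_le_of_le_one h0.le h1.le (by omega)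
  have hq0 : 0 < ρ ^ (2 * m + n) := by positivity
  have hb1 : r ^ (2 * m + n) ≤ b ^ (2 * m + n) := by gcongr
  have hb2 : (ρ / r) ^ (2 * m + n) ≤ b ^ (2 * m + n) := by gcongr
  have hb : 0 < b := hr0.trans_le hr
  exact div_le_div₀ (by positivity) (by linarith) (by linarith) (by linarith)

theorem continuousAt_radialFactor (hr0 : r ≠ 0) : ContinuousAt (radialFactor n m ρ) r := by
  unfold radialFactor
  fun_prop (disch := exact hr0)

end RadialFactor

/-! ### Growth, monotonicity and closed form of `peakConst` -/

section PeakConst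

theorem peakConst_eq (n k : ℕ) :
    peakConst (n + 2) k = ∑ j ∈ Ico 1 k, 1 / (2 * Real.sin (Real.pi * j / k)) ^ n := rfl

theorem peakConst_pos (n : ℕ) {k : ℕ} (hk : 2 ≤ k) : 0 < peakConst (n + 2) k := by
  rw [peakConst_eq]
  refine Finset.sum_pos (fun j hj => ?_) ⟨1, by simp; omega⟩
  have := sin_peak_pos hj
  positivity

theorem one_div_two_sin_pow_lt {n : ℕ} (hn : n ≠ 0) {x y : ℝ} (hx : 0 < x) (hxy : x < y)
    (hy : y ≤ Real.pi / 2) : 1 / (2 * Real.sin y) ^ n < 1 / (2 * Real.sin x) ^ n := by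
  have h1 : 0 < Real.sin x := Real.sin_pos_of_pos_of_lt_pi hx (by linarith [Real.pi_pos])
  have h2 : Real.sin x < Real.sin y :=
    Real.sin_lt_sin_of_lt_of_le_pi_div_two (by linarith [Real.pi_pos]) hy hxy
  exact one_div_lt_one_div_of_lt (by positivity)
    (pow_lt_pow_left₀ (by linarith) (by positivity) hn)

theorem one_div_two_sin_peak_lt {n : ℕ} (hn : n ≠ 0) {k j : ℕ} (hj : 0 < j) (hjk : 2 * j ≤ k) :
    1 / (2 * Real.sin (Real.pi * j / k)) ^ n <
      1 / (2 * Real.sin (Real.pi * j / (k + 1 : ℕ))) ^ n := by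
  have hj0 : (0 : ℝ) < j := by exact_mod_cast hj
  have hk0 : (0 : ℝ) < k := by exact_mod_cast (by omega : 0 < k)
  have hπj : 0 < Real.pi * j := mul_pos Real.pi_pos hj0
  have h2 : 2 * (j : ℝ) ≤ k := by exact_mod_cast hjk
  push_cast
  refine one_div_two_sin_pow_lt hn (by positivity) ?_ ?_
  · exact div_lt_div_of_pos_left hπj hk0 (by linarith)
  · rw [div_le_div_iff₀ hk0 two_pos]
    nlinarith [Real.pi_pos]

theorem sin_peak_sub {k j : ℕ} (hk : 0 < k) (hjk : j ≤ k) :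
    Real.sin (Real.pi * j / k) = Real.sin (Real.pi * (k - j : ℕ) / k) := by
  have hk0 : (k : ℝ) ≠ 0 := by exact_mod_cast hk.ne'
  rw [← Real.sin_pi_sub, Nat.cast_sub hjk]
  congr 1
  field_simp

theorem peakConst_lt_succ {n : ℕ} (hn : n ≠ 0) {k : ℕ} (hk : 2 ≤ k) :
    peakConst (n + 2) k < peakConst (n + 2) (k + 1) := by
  rw [peakConst_eq, peakConst_eq]
  -- An index in the lower half keeps its distance from `0`, one in the upper half its distance from
  -- the right end. The angle to the nearer end then shrinks from `k` to `k + 1`, so every term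
  -- grows.
  let g : ℕ → ℕ := fun j => if 2 * j ≤ k then j else j + 1
  have hg : Set.InjOn g (Ico 1 k : Finset ℕ) := by
    intro a _ b _ hab
    simp only [g] at hab
    split_ifs at hab <;> omega
  have hsub : (Ico 1 k).image g ⊆ Ico 1 (k + 1) := by
    intro i hi
    obtain ⟨j, hj, rfl⟩ := Finset.mem_image.1 hi
    rw [Finset.mem_Ico] at hj ⊢
    simp only [g]
    split_ifs <;> omega
  calc ∑ j ∈ Ico 1 k, 1 / (2 * Real.sin (Real.pi * j / k)) ^ n
      < ∑ j ∈ Ico 1 k, 1 / (2 * Real.sin (Real.pi * g j / (k + 1 : ℕ))) ^ n := by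
        refine Finset.sum_lt_sum_of_nonempty ⟨1, by simp; omega⟩ fun j hj => ?_
        rw [Finset.mem_Ico] at hj
        simp only [g]
        split_ifs with h
        · exact one_div_two_sin_peak_lt hn (by omega) h
        · rw [sin_peak_sub (by omega) hj.2.le, sin_peak_sub (k := k + 1) (by omega) (by omega),
            show k + 1 - (j + 1) = k - j by omega]
          exact one_div_two_sin_peak_lt hn (by omega) (by omega)
    _ = ∑ i ∈ (Ico 1 k).image g, 1 / (2 * Real.sin (Real.pi * i / (k + 1 : ℕ))) ^ n :=
        (Finset.sum_image (f := fun i : ℕ => 1 / (2 * Real.sin (Real.pi * i / (k + 1 : ℕ))) ^ n)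
          hg).symm
    _ ≤ _ := by
        refine Finset.sum_le_sum_of_subset_of_nonneg hsub fun i hi _ => ?_
        have := sin_peak_pos hi
        positivity

theorem strictMonoOn_peakConst {n : ℕ} (hn : n ≠ 0) :
    StrictMonoOn (fun k => peakConst (n + 2) k) (Set.Ici 2) := by
  intro a ha b _ hab
  induction b, hab using Nat.le_induction with
  | base => exact peakConst_lt_succ hn ha
  | succ b hb ih =>
    have ha' : 2 ≤ a := ha
    exact (ih (by simp; omega)).trans (peakConst_lt_succ hn (by omega))

/-- From `sin x ≤ x` and `(j/k)^n ≤ j/k`; the harmonic sum is a crude bound for larger `n` but it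
diverges for every `n ≥ 1`. -/
theorem le_peakConst_div {n : ℕ} (hn : n ≠ 0) {k : ℕ} (hk : 0 < k) :
    ((2 * Real.pi) ^ n)⁻¹ * ∑ j ∈ range k, 1 / (j : ℝ) ≤ peakConst (n + 2) k / k := by
  have hk0 : (0 : ℝ) < k := by exact_mod_cast hk
  -- The term `j = 0` of the harmonic sum is `1 / 0 = 0`.
  rw [peakConst_eq, Finset.sum_range_eq_add_Ico _ hk, Nat.cast_zero, div_zero, zero_add,
    Finset.mul_sum, Finset.sum_div]
  refine Finset.sum_le_sum fun j hj => ?_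
  have hs := sin_peak_pos hj
  obtain ⟨h1, h2⟩ := Finset.mem_Ico.1 hj
  have hj0 : (0 : ℝ) < j := by exact_mod_cast h1
  have hjk : (j : ℝ) ≤ k := by exact_mod_cast h2.le
  have hπ := Real.pi_pos
  have hle : Real.sin (Real.pi * j / k) ≤ Real.pi * (j / k) := by
    rw [← mul_div_assoc]
    exact Real.sin_le (by positivity)
  have h3 : (2 * Real.sin (Real.pi * j / k)) ^ n ≤ (2 * Real.pi) ^ n * (j / k) := by
    calc (2 * Real.sin (Real.pi * j / k)) ^ n ≤ (2 * Real.pi * (j / k)) ^ n :=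
          pow_le_pow_left₀ (by linarith) (by linarith) n
      _ = (2 * Real.pi) ^ n * (j / k) ^ n := mul_pow _ _ _
      _ ≤ (2 * Real.pi) ^ n * (j / k) := by
          refine mul_le_mul_of_nonneg_left ?_ (by positivity)
          exact pow_le_of_le_one (by positivity) ((div_le_one hk0).2 hjk) hn
  calc ((2 * Real.pi) ^ n)⁻¹ * (1 / j) = 1 / ((2 * Real.pi) ^ n * (j / k)) / k := by field_simp
    _ ≤ _ := by
      gcongr

theorem tendsto_peakConst_div {n : ℕ} (hn : n ≠ 0) :
    Tendsto (fun k : ℕ => peakConst (n + 2) k / k) atTop atTop := by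
  have h := (not_summable_iff_tendsto_nat_atTop_of_nonneg (fun j : ℕ => by positivity)).1
    Real.not_summable_one_div_natCast
  refine tendsto_atTop_mono' _ ?_
    (h.const_mul_atTop (by have := Real.pi_pos; positivity : 0 < ((2 * Real.pi) ^ n)⁻¹))
  filter_upwards [eventually_gt_atTop 0] with k hk
  exact le_peakConst_div hn hk

theorem sum_geom_root {k : ℕ} {w : ℂ} (hw : w ^ k = 1) (h1 : w ≠ 1) :
    ∑ j ∈ range k, w ^ j = 0 := by
  have := mul_geom_sum w k
  rw [hw, sub_self] at this
  exact (mul_eq_zero.1 this).resolve_left (sub_ne_zero.2 h1)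

/-- Summation by parts. At a `k`-th root of unity `w ≠ 1` the right side is `k`. -/
theorem sub_one_mul_sum_mul_pow (w : ℂ) (k : ℕ) :
    (w - 1) * ∑ l ∈ range k, (l : ℂ) * w ^ l = k * w ^ k - w * ∑ l ∈ range k, w ^ l := by
  induction k with
  | zero => simp
  | succ k ih =>
    rw [Finset.sum_range_succ, Finset.sum_range_succ, mul_add, ih]
    push_cast
    ring

theorem sum_range_cast (k : ℕ) : ∑ l ∈ range k, (l : ℝ) = k * (k - 1) / 2 := by
  induction k with
  | zero => simp
  | succ k ih =>
    rw [Finset.sum_range_succ, ih]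
    push_cast
    ring

theorem sum_range_cast_sq (k : ℕ) :
    ∑ l ∈ range k, (l : ℝ) ^ 2 = k * (k - 1) * (2 * k - 1) / 6 := by
  induction k with
  | zero => simp
  | succ k ih =>
    rw [Finset.sum_range_succ, ih]
    push_cast
    ring

/-- Parseval's identity for the function `l ↦ l` on the cyclic group of order `k`. -/
theorem sum_normSq_sum_mul_pow {k : ℕ} (hk : k ≠ 0) {ζ : ℂ} (hζ : IsPrimitiveRoot ζ k) :
    ∑ j ∈ range k, Complex.normSq (∑ l ∈ range k, (l : ℂ) * (ζ ^ j) ^ l) =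
      k * ∑ l ∈ range k, (l : ℝ) ^ 2 := by
  have hζn : ‖ζ‖ = 1 := hζ.norm'_eq_one hk
  have hζ0 : ζ ≠ 0 := hζ.ne_zero hk
  have hc : (starRingEnd ℂ) ζ = ζ⁻¹ := (Complex.inv_eq_conj hζn).symm
  have hortho : ∀ l ∈ range k, ∀ l' ∈ range k,
      ∑ j ∈ range k, (ζ ^ l * (ζ⁻¹) ^ l') ^ j = if l = l' then (k : ℂ) else 0 := by
    intro l hl l' hl'
    split_ifs with h
    · subst h
      rw [← mul_pow, mul_inv_cancel₀ hζ0]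
      simp
    · refine sum_geom_root ?_ ?_
      · rw [mul_pow, ← pow_mul, ← pow_mul, mul_comm l, mul_comm l', pow_mul, pow_mul, inv_pow,
          hζ.pow_eq_one]
        simp
      · intro h2
        rw [inv_pow, mul_inv_eq_one₀ (pow_ne_zero _ hζ0)] at h2
        exact h (hζ.pow_inj (Finset.mem_range.1 hl) (Finset.mem_range.1 hl') h2)
  have key : ∑ j ∈ range k, ((Complex.normSq (∑ l ∈ range k, (l : ℂ) * (ζ ^ j) ^ l) : ℝ) : ℂ) =
      k * ∑ l ∈ range k, (l : ℂ) ^ 2 := by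
    have e : ∀ j, ((Complex.normSq (∑ l ∈ range k, (l : ℂ) * (ζ ^ j) ^ l) : ℝ) : ℂ) =
        ∑ l ∈ range k, ∑ l' ∈ range k, (l : ℂ) * l' * (ζ ^ l * (ζ⁻¹) ^ l') ^ j := by
      intro j
      rw [← Complex.mul_conj, map_sum, Finset.sum_mul_sum]
      refine Finset.sum_congr rfl fun l _ => Finset.sum_congr rfl fun l' _ => ?_
      rw [map_mul, map_pow, map_pow, hc, Complex.conj_natCast]
      ring
    rw [Finset.sum_congr rfl fun j _ => e j, Finset.sum_comm, Finset.mul_sum]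
    refine Finset.sum_congr rfl fun l hl => ?_
    rw [Finset.sum_comm]
    have e2 : ∀ l' ∈ range k, ∑ j ∈ range k, (l : ℂ) * l' * (ζ ^ l * (ζ⁻¹) ^ l') ^ j =
        if l = l' then (l : ℂ) * l' * k else 0 := by
      intro l' hl'
      rw [← Finset.mul_sum, hortho l hl l' hl']
      split_ifs <;> simp
    rw [Finset.sum_congr rfl e2, Finset.sum_ite_eq, if_pos hl]
    ring
  exact_mod_cast key

/-- The Fourier transform of `l ↦ l` at a frequency `j ≠ 0` is `k / (ζ^j - 1)`, and `|ζ^j - 1| = 2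
sin(πj/k)`. Parseval, with the frequency `0` split off, gives the sum. -/
theorem peakConst_four {k : ℕ} (hk : 2 ≤ k) : peakConst 4 k = ((k : ℝ) ^ 2 - 1) / 12 := by
  have hk0 : k ≠ 0 := by omega
  have hkr : (k : ℝ) ≠ 0 := by exact_mod_cast hk0
  have hζ := Complex.isPrimitiveRoot_exp k hk0
  set ζ := Complex.exp (2 * Real.pi * Complex.I / k) with hζd
  have h := sum_normSq_sum_mul_pow hk0 hζ
  rw [Finset.sum_range_eq_add_Ico _ (Nat.pos_of_ne_zero hk0), sum_range_cast_sq] at h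
  have h0 : Complex.normSq (∑ l ∈ range k, (l : ℂ) * (ζ ^ 0) ^ l) =
      ((k : ℝ) * (k - 1) / 2) ^ 2 := by
    rw [← sum_range_cast]
    simp only [pow_zero, one_pow, mul_one]
    rw [show ∑ l ∈ range k, (l : ℂ) = ((∑ l ∈ range k, (l : ℝ) : ℝ) : ℂ) by push_cast; rfl,
      Complex.normSq_ofReal, sq]
  have hj : ∀ j ∈ Ico 1 k, Complex.normSq (∑ l ∈ range k, (l : ℂ) * (ζ ^ j) ^ l) =
      (k : ℝ) ^ 2 * (1 / (2 * Real.sin (Real.pi * j / k)) ^ 2) := by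
    intro j hj
    have hs := sin_peak_pos hj
    obtain ⟨hj1, hj2⟩ := Finset.mem_Ico.1 hj
    have hne : ζ ^ j ≠ 1 := hζ.pow_ne_one_of_pos_of_lt (by omega) hj2
    have hpow : (ζ ^ j) ^ k = 1 := by rw [← pow_mul, mul_comm, pow_mul, hζ.pow_eq_one, one_pow]
    have hm := sub_one_mul_sum_mul_pow (ζ ^ j) k
    rw [hpow, sum_geom_root hpow hne, mul_zero, sub_zero, mul_one] at hm
    have hn := congrArg Complex.normSq hm
    rw [Complex.normSq_mul, Complex.normSq_natCast] at hn
    have hd : Complex.normSq (ζ ^ j - 1) = (2 * Real.sin (Real.pi * j / k)) ^ 2 := by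
      have e := one_sub_two_mul_cos_add_sq 1 (2 * (Real.pi * j / k))
      rw [Complex.ofReal_one, mul_one (Complex.exp _), norm_sub_rev] at e
      have e2 : Complex.exp (((2 * (Real.pi * j / k) : ℝ) : ℂ) * Complex.I) = ζ ^ j := by
        rw [hζd, ← Complex.exp_nat_mul]
        congr 1
        push_cast
        ring
      rw [e2, ← Complex.normSq_eq_norm_sq] at e
      rw [← e, Real.cos_two_mul, mul_pow, Real.sin_sq]
      ring
    rw [hd] at hn
    field_simp at hn ⊢
    linarith
  rw [h0, Finset.sum_congr rfl hj, ← Finset.mul_sum] at h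
  rw [show (4 : ℕ) = 2 + 2 from rfl, peakConst_eq]
  have hk2 : (k : ℝ) ^ 2 ≠ 0 := by positivity
  refine mul_left_cancel₀ hk2 ?_
  linear_combination h

theorem strictMonoOn_peakConst_four_div :
    StrictMonoOn (fun k : ℕ => peakConst 4 k / k) (Set.Ici 2) := by
  intro a ha b hb hab
  have ha0 : (0 : ℝ) < a := by exact_mod_cast lt_of_lt_of_le two_pos ha
  have hab' : (a : ℝ) < b := by exact_mod_cast hab
  have hb0 : (0 : ℝ) < b := ha0.trans hab'
  simp only
  rw [peakConst_four ha, peakConst_four hb, div_lt_div_iff₀ ha0 hb0]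
  nlinarith [mul_pos ha0 hb0]

end PeakConst

/-! ### The explicit lower bound for the threshold -/

section ThresholdBound

theorem thresholdParam_eq (p k : ℕ) :
    thresholdParam (p + 3) k =
      (peakConst (p + 3) k / k * (2 * ((p + 1 : ℕ) : ℝ) ^ p)⁻¹) ^ (2 / ((p + 1 : ℕ) : ℝ)) := by
  rw [thresholdParam, show ((p + 3 : ℕ) : ℝ) - 2 = ((p + 1 : ℕ) : ℝ) by push_cast; ring,
    Nat.add_sub_cancel]
  congr 1
  generalize ((p + 1 : ℕ) : ℝ) ^ p = x
  ring

theorem thresholdParam_pos (p : ℕ) {k : ℕ} (hk : 2 ≤ k) : 0 < thresholdParam (p + 3) k := by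
  rw [thresholdParam_eq]
  have h := peakConst_pos (p + 1) hk
  have hk0 : (0 : ℝ) < k := by exact_mod_cast (by omega : 0 < k)
  have : (0 : ℝ) < ((p + 1 : ℕ) : ℝ) := by positivity
  exact Real.rpow_pos_of_pos (mul_pos (div_pos h hk0) (by positivity)) _

theorem tendsto_thresholdParam (p : ℕ) :
    Tendsto (fun k : ℕ => thresholdParam (p + 3) k) atTop atTop := by
  simp only [thresholdParam_eq]
  have h1 : (0 : ℝ) < ((p + 1 : ℕ) : ℝ) := by positivity
  exact (tendsto_rpow_atTop (by positivity)).comp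
    ((tendsto_peakConst_div (n := p + 1) (by omega)).atTop_mul_const (by positivity))

/-- `thresholdBound` is the smaller root of `a (1 - ρ)² = ρ`. The hypothesis gives `(2a(1 - ρ) + 1)²
< 4a + 1`. -/
theorem thresholdBound_lt {N k : ℕ} {ρ : ℝ} (ha : 0 < thresholdParam N k)
    (h : thresholdParam N k * (1 - ρ) ^ 2 < ρ) : thresholdBound N k < ρ := by
  rw [thresholdBound]
  set a := thresholdParam N k
  have h1 : 2 * a * (1 - ρ) + 1 < √(4 * a + 1) := by
    refine Real.lt_sqrt_of_sq_lt ?_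
    nlinarith
  rw [div_lt_iff₀ (by positivity)]
  linarith

theorem thresholdBound_le_one {N k : ℕ} (ha : 0 < thresholdParam N k) : thresholdBound N k ≤ 1 := by
  rw [thresholdBound, div_le_one (by positivity)]
  have : 1 ≤ √(4 * thresholdParam N k + 1) := Real.one_le_sqrt.2 (by linarith)
  linarith

/-- From `√(4a + 1) ≤ 2√a + 1`; it forces the limit `1` as `a` grows. -/
theorem le_thresholdBound {N k : ℕ} (ha : 0 < thresholdParam N k) :
    1 - (√(thresholdParam N k))⁻¹ ≤ thresholdBound N k := by
  rw [thresholdBound]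
  set a := thresholdParam N k
  have hs : 0 < √a := Real.sqrt_pos.2 ha
  have hsq : √a ^ 2 = a := Real.sq_sqrt ha.le
  have h1 : √(4 * a + 1) ≤ 2 * √a + 1 := by
    refine Real.sqrt_le_iff.2 ⟨by positivity, ?_⟩
    nlinarith
  rw [le_div_iff₀ (by positivity)]
  have e : (1 - (√a)⁻¹) * (2 * a) = 2 * a - 2 * √a := by
    have h2 : (√a)⁻¹ * a = √a := by rw [inv_mul_eq_iff_eq_mul₀ hs.ne', ← sq, hsq]
    linear_combination (-2) * h2
  rw [e]
  linarith

theorem tendsto_thresholdBound (p : ℕ) :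
    Tendsto (fun k : ℕ => thresholdBound (p + 3) k) atTop (𝓝 1) := by
  have h : Tendsto (fun k : ℕ => 1 - (√(thresholdParam (p + 3) k))⁻¹) atTop (𝓝 1) := by
    simpa using (tendsto_inv_atTop_zero.comp
      (Real.tendsto_sqrt_atTop.comp (tendsto_thresholdParam p))).const_sub 1
  refine tendsto_of_tendsto_of_tendsto_of_le_of_le' h tendsto_const_nhds ?_ ?_
  · filter_upwards [eventually_ge_atTop 2] with k hk
    exact le_thresholdBound (thresholdParam_pos p hk)
  · filter_upwards [eventually_ge_atTop 2] with k hk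
    exact thresholdBound_le_one (thresholdParam_pos p hk)

theorem thresholdBound_lt_sq (p : ℕ) {k : ℕ} (hk : 2 ≤ k) {σ : ℝ} (h0 : 0 < σ) (h1 : σ < 1)
    (hσ : thresholdSeries (p + 1) k σ = peakConst (p + 3) k) :
    thresholdBound (p + 3) k < σ ^ 2 := by
  have hk0 : (0 : ℝ) < k := by exact_mod_cast (by omega : 0 < k)
  have hp1 : (1 : ℝ) ≤ ((p + 1 : ℕ) : ℝ) := by exact_mod_cast (by omega : 1 ≤ p + 1)
  have hσ2 : 0 < 1 - σ ^ 2 := by nlinarith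
  refine thresholdBound_lt (thresholdParam_pos p hk) ?_
  have hC := (thresholdSeries_lt (n := p + 1) (k := k) (by omega) (by omega) h0 h1).trans_le
    (mul_le_mul_of_nonneg_left (orbitSeries_le (by omega) k h0.le h1) zero_le_two)
  rw [hσ] at hC
  have hpos := peakConst_pos (p + 1) hk
  have hX : 0 < σ / (1 - σ ^ 2) := by positivity
  have hlt : peakConst (p + 3) k / k * (2 * ((p + 1 : ℕ) : ℝ) ^ p)⁻¹ <
      (σ / (1 - σ ^ 2)) ^ (p + 1) := by
    -- The factor `(N - 2)^{N - 3} ≥ 1` in the definition of `a` only weakens the estimate.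
    have hpp : 1 ≤ ((p + 1 : ℕ) : ℝ) ^ p := one_le_pow₀ hp1
    rw [← div_eq_mul_inv, div_div, div_lt_iff₀ (by positivity)]
    refine hC.trans_le ?_
    have : 0 < k * (σ / (1 - σ ^ 2)) ^ (p + 1) := by positivity
    nlinarith
  have ha : thresholdParam (p + 3) k < (σ / (1 - σ ^ 2)) ^ 2 := by
    rw [thresholdParam_eq]
    have h := Real.rpow_lt_rpow (z := 2 / ((p + 1 : ℕ) : ℝ))
      (mul_nonneg (div_pos hpos hk0).le (by positivity)) hlt (by positivity)
    refine h.trans_eq ?_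
    rw [← Real.rpow_natCast, ← Real.rpow_mul hX.le, mul_div_cancel₀ _ (by positivity)]
    norm_cast
  rw [div_pow, lt_div_iff₀ (by positivity)] at ha
  exact ha

end ThresholdBound

/-! ### Existence and sign of the minimum -/

section Minimum

variable {n k : ℕ} (hn : n ≠ 0) (hk : k ≠ 0) {ρ r : ℝ}

include hn hk in
theorem thresholdSeries_le_Lambda1 {σ : ℝ} (h0 : 0 < σ) (h1 : σ < 1) (hr : σ ^ 2 < r)
    (hr1 : r < 1) : thresholdSeries n k σ ≤
      sphereArea (n + 2) * n * r ^ n * Lambda1 (n + 2) k (σ ^ 2) r + peakConst (n + 2) k := by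
  have hρ : 0 < σ ^ 2 := by positivity
  refine hasSum_le (fun m => ?_) (summable_thresholdSeries hn hk h0.le h1).hasSum
    (hasSum_Lambda1 hn hk hρ hr hr1)
  exact mul_le_mul_of_nonneg_left
    (le_radialFactor hn hρ (hr.trans hr1) (hρ.trans hr) h0 rfl) (orbitCoeff_half_nonneg hn hk m)

include hn hk in
theorem thresholdSeries_eq_Lambda1 {σ : ℝ} (h0 : 0 < σ) (h1 : σ < 1) : thresholdSeries n k σ =
      sphereArea (n + 2) * n * σ ^ n * Lambda1 (n + 2) k (σ ^ 2) σ + peakConst (n + 2) k := by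
  have hρ : 0 < σ ^ 2 := by positivity
  refine (summable_thresholdSeries hn hk h0.le h1).hasSum.unique
    ((hasSum_Lambda1 hn hk hρ (by nlinarith) h1).congr_of_eq (fun m => ?_) rfl)
  rw [radialFactor_sqrt hn h0 h1]

include hn hk in
theorem orbitSeries_sub_le_Lambda1 (h0 : 0 < ρ) (hr : ρ < r) (hr1 : r < 1) {z : ℝ}
    (hz : z = r ∨ z = ρ / r) : orbitSeries n k z - orbitSeries n k ρ ≤
      sphereArea (n + 2) * n * r ^ n * Lambda1 (n + 2) k ρ r + peakConst (n + 2) k := by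
  have hr0 : 0 < r := h0.trans hr
  have hz0 : 0 ≤ z := by rcases hz with rfl | rfl <;> positivity
  have hz1 : z < 1 := by
    rcases hz with rfl | rfl
    · exact hr1
    · exact (div_lt_one hr0).2 hr
  refine hasSum_le (fun m => ?_) ((hasSum_orbitSeries hn k hz0 hz1).1.sub
    (hasSum_orbitSeries hn k h0.le (hr.trans hr1)).1) (hasSum_Lambda1 hn hk h0 hr hr1)
  rw [← mul_sub]
  refine mul_le_mul_of_nonneg_left ?_ (orbitCoeff_half_nonneg hn hk m)
  have h := sub_le_radialFactor (m := m) hn h0 hr hr1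
  rcases hz with rfl | rfl
  · exact h.1
  · exact h.2

include hn hk in
theorem continuousOn_Lambda1 (h0 : 0 < ρ) {b : ℝ} (hb0 : 0 < b) (hb1 : b < 1) :
    ContinuousOn (Lambda1 (n + 2) k ρ) (Set.Icc (ρ / b) b) := by
  have hω := sphereArea_pos n
  have hn0 : (0 : ℝ) < n := Nat.cast_pos.2 (Nat.pos_of_ne_zero hn)
  have hpos : ∀ r ∈ Set.Icc (ρ / b) b, 0 < r ∧ ρ < r ∧ r < 1 ∧ ρ / r ≤ b := fun r hr => by
    have h1 : ρ < ρ / b := (lt_div_iff₀ hb0).2 (by nlinarith)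
    have h2 : 0 < r := (div_pos h0 hb0).trans_le hr.1
    refine ⟨h2, h1.trans_le hr.1, hr.2.trans_lt hb1, ?_⟩
    rw [div_le_iff₀ h2, mul_comm, ← div_le_iff₀ hb0]
    exact hr.1
  have hc : ContinuousOn
      (fun r => ∑' m, orbitCoeff ((n : ℝ) / 2) k m * radialFactor n m ρ r)
      (Set.Icc (ρ / b) b) := by
    refine continuousOn_tsum (fun m r hr => ?_)
      ((hasSum_orbitSeries hn k hb0.le hb1).1.summable.mul_left (2 / (1 - ρ))) fun m r hr => ?_
    · exact (continuousAt_const.mul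
        (continuousAt_radialFactor (hpos r hr).1.ne')).continuousWithinAt
    · obtain ⟨hr0, hρr, hr1, hrb⟩ := hpos r hr
      have hcm := orbitCoeff_half_nonneg hn hk m
      have hle := radialFactor_le (m := m) hn h0 (hρr.trans hr1) hr0 hr.2 hrb
      have hge := (sub_le_radialFactor (m := m) hn h0 hρr hr1).1
      have hge' : ρ ^ (2 * m + n) ≤ r ^ (2 * m + n) := pow_le_pow_left₀ h0.le hρr.le _
      rw [Real.norm_of_nonneg (mul_nonneg hcm (by linarith))]
      refine (mul_le_mul_of_nonneg_left hle hcm).trans_eq ?_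
      ring
  have he : Set.EqOn (Lambda1 (n + 2) k ρ) (fun r =>
      ((∑' m, orbitCoeff ((n : ℝ) / 2) k m * radialFactor n m ρ r) - peakConst (n + 2) k) /
        (sphereArea (n + 2) * n * r ^ n)) (Set.Icc (ρ / b) b) := by
    intro r hr
    obtain ⟨hr0, hρr, hr1, -⟩ := hpos r hr
    simp only
    rw [(hasSum_Lambda1 hn hk h0 hρr hr1).tsum_eq, add_sub_cancel_right,
      mul_div_cancel_left₀ _ (by positivity)]
  refine ContinuousOn.congr ?_ he
  refine (hc.sub continuousOn_const).div (by fun_prop) fun r hr => ?_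
  have := (hpos r hr).1
  positivity

include hn hk in
theorem exists_forall_le_Lambda1 (h0 : 0 < ρ) (M : ℝ) :
    ∃ b ∈ Set.Ioo (0 : ℝ) 1, ∀ r ∈ Set.Ioo ρ 1, r ∉ Set.Icc (ρ / b) b →
      M ≤ Lambda1 (n + 2) k ρ r := by
  have hω := sphereArea_pos n
  have hn0 : (0 : ℝ) < n := Nat.cast_pos.2 (Nat.pos_of_ne_zero hn)
  set A : ℝ := sphereArea (n + 2) * n with hA
  have hA0 : 0 < A := by positivity
  obtain ⟨b, hb, hbM⟩ := exists_forall_le_orbitSeries hn hk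
    (A * |M| + peakConst (n + 2) k + orbitSeries n k ρ)
  refine ⟨b, hb, fun r hr hrb => ?_⟩
  have hr0 : 0 < r := h0.trans hr.1
  -- Using `|M|` forces `Λ₁ ≥ 0`, so the factor `r^n ≤ 1` can be dropped afterwards.
  have key : A * |M| ≤ A * (r ^ n * Lambda1 (n + 2) k ρ r) := by
    by_cases h : b < r
    · have h1 := hbM r h.le hr.2
      have h2 := orbitSeries_sub_le_Lambda1 hn hk h0 hr.1 hr.2 (Or.inl rfl)
      linarith
    · have h3 : r < ρ / b := by
        by_contra! h4
        exact hrb ⟨h4, not_lt.1 h⟩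
      have h5 : b < ρ / r := by
        rw [lt_div_iff₀ hr0, mul_comm, ← lt_div_iff₀ hb.1]
        exact h3
      have h1 := hbM (ρ / r) h5.le ((div_lt_one hr0).2 hr.1)
      have h2 := orbitSeries_sub_le_Lambda1 hn hk h0 hr.1 hr.2 (Or.inr rfl)
      linarith
  have h1 := le_of_mul_le_mul_left key hA0
  have hrn : r ^ n ≤ 1 := pow_le_one₀ hr0.le hr.2.le
  have hrn0 : 0 < r ^ n := by positivity
  have h2 : 0 ≤ Lambda1 (n + 2) k ρ r := by
    by_contra! h
    have : r ^ n * Lambda1 (n + 2) k ρ r < 0 := mul_neg_of_pos_of_neg hrn0 h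
    linarith [abs_nonneg M]
  nlinarith [le_abs_self M]

include hn hk in
theorem exists_isLeast_Lambda1 (h0 : 0 < ρ) (h1 : ρ < 1) :
    ∃ r ∈ Set.Ioo ρ 1, minLambda1 (n + 2) k ρ = Lambda1 (n + 2) k ρ r ∧
      IsLeast (Lambda1 (n + 2) k ρ '' Set.Ioo ρ 1) (minLambda1 (n + 2) k ρ) := by
  obtain ⟨s, hs⟩ := Set.nonempty_Ioo.2 h1
  -- The level `Λ₁(s) + 1` puts `s` inside the compact interval, so the minimum there is global.
  obtain ⟨b, hb, hbM⟩ := exists_forall_le_Lambda1 hn hk h0 (Lambda1 (n + 2) k ρ s + 1)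
  have hsK : s ∈ Set.Icc (ρ / b) b := by
    by_contra h
    have := hbM s hs h
    linarith
  have hsub : Set.Icc (ρ / b) b ⊆ Set.Ioo ρ 1 := fun r hr =>
    ⟨((lt_div_iff₀ hb.1).2 (by nlinarith [hb.2])).trans_le hr.1, hr.2.trans_lt hb.2⟩
  obtain ⟨r, hr, hmin⟩ := isCompact_Icc.exists_isMinOn ⟨s, hsK⟩
    (continuousOn_Lambda1 hn hk h0 hb.1 hb.2)
  have hl : IsLeast (Lambda1 (n + 2) k ρ '' Set.Ioo ρ 1) (Lambda1 (n + 2) k ρ r) := by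
    refine ⟨⟨r, hsub hr, rfl⟩, ?_⟩
    rintro _ ⟨t, ht, rfl⟩
    by_cases htK : t ∈ Set.Icc (ρ / b) b
    · exact hmin htK
    · have h2 := hbM t ht htK
      have h3 : Lambda1 (n + 2) k ρ r ≤ Lambda1 (n + 2) k ρ s := hmin hsK
      linarith
  have he : minLambda1 (n + 2) k ρ = Lambda1 (n + 2) k ρ r := hl.csInf_eq
  exact ⟨r, hsub hr, he, he ▸ hl⟩

include hn hk in
-- The termwise lower bound is used at the actual minimizer and the equality at `r = σ`. The weights
-- `ω n r^n` are positive, so signs survive even if these radii differ.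
theorem minLambda1_sign {σ : ℝ} (h0 : 0 < σ) (h1 : σ < 1) :
    (peakConst (n + 2) k < thresholdSeries n k σ → 0 < minLambda1 (n + 2) k (σ ^ 2)) ∧
    (thresholdSeries n k σ < peakConst (n + 2) k → minLambda1 (n + 2) k (σ ^ 2) < 0) ∧
    (thresholdSeries n k σ = peakConst (n + 2) k → minLambda1 (n + 2) k (σ ^ 2) = 0) := by
  have hω := sphereArea_pos n
  have hn0 : (0 : ℝ) < n := Nat.cast_pos.2 (Nat.pos_of_ne_zero hn)
  have hρ : 0 < σ ^ 2 := by positivity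
  have hσ : σ ∈ Set.Ioo (σ ^ 2) 1 := ⟨by nlinarith, h1⟩
  obtain ⟨r, hr, hmin, hl⟩ := exists_isLeast_Lambda1 (n := n) hn hk hρ (hσ.1.trans h1)
  have hr0 : 0 < r := hρ.trans hr.1
  have hle : minLambda1 (n + 2) k (σ ^ 2) ≤ Lambda1 (n + 2) k (σ ^ 2) σ := hl.2 ⟨σ, hσ, rfl⟩
  have e1 := thresholdSeries_le_Lambda1 hn hk h0 h1 hr.1 hr.2
  have e2 := thresholdSeries_eq_Lambda1 (k := k) hn hk h0 h1
  rw [← hmin] at e1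
  have p1 : 0 < sphereArea (n + 2) * n * r ^ n := by positivity
  have p2 : 0 < sphereArea (n + 2) * n * σ ^ n := by positivity
  have neg : ∀ {x}, thresholdSeries n k σ ≤ x → x ≤ peakConst (n + 2) k →
      minLambda1 (n + 2) k (σ ^ 2) ≤ 0 := fun hx hx' => by
    refine hle.trans (nonpos_of_mul_nonpos_right ?_ p2)
    linarith
  refine ⟨fun h => pos_of_mul_pos_right (by linarith) p1.le, fun h => hle.trans_lt ?_, fun h =>
    le_antisymm (neg h.le le_rfl) (nonneg_of_mul_nonneg_right (by linarith) p1)⟩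
  exact neg_of_mul_neg_right (by linarith : sphereArea (n + 2) * n * σ ^ n * _ < 0) p2.le

end Minimum

/-! ### The threshold equation in terms of zonal harmonics -/

/-- `d_m` is the zonal harmonic at angle `0`, so it supplies the missing term `j = 0` of the orbit
sum. -/
theorem harmonicDim_eq (p m : ℕ) : (harmonicDim (p + 3) m : ℝ) =
    (2 * m + (p + 1 : ℕ)) / (p + 1 : ℕ) * gegenbauerCos (((p + 1 : ℕ) : ℝ) / 2) m 0 := by
  have h1 : ((m + p + 1) * (m + p).choose p : ℝ) = (m + p + 1).choose (p + 1) * (p + 1) := by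
    exact_mod_cast Nat.add_one_mul_choose_eq (m + p) p
  have h2 : ((m + p).choose (p + 1) * (p + 1) : ℝ) = (m + p).choose p * m := by
    have h := Nat.choose_succ_right_eq (m + p) p
    rw [Nat.add_sub_cancel] at h
    exact_mod_cast h
  rw [gegenbauerCos_at_zero, harmonicDim, show m + (p + 3) - 2 = m + p + 1 by omega,
    show m + (p + 3) - 3 = m + p by omega, show p + 3 - 2 = p + 1 by omega, div_mul_eq_mul_div,
    eq_div_iff (by positivity)]
  push_cast
  linear_combination h2 - h1

theorem zonalHarmonic_peak (p k m j : ℕ) :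
    zonalHarmonic m (peak (p + 3) k 1 1) (peak (p + 3) k (j + 1) 1) =
      (2 * m + (p + 1 : ℕ)) / (p + 1 : ℕ) *
        gegenbauerCos (((p + 1 : ℕ) : ℝ) / 2) m (2 * Real.pi * j / k) := by
  rw [zonalHarmonic, peak_inner, one_pow, one_mul,
    show ((p + 3 : ℕ) : ℝ) - 2 = ((p + 1 : ℕ) : ℝ) by push_cast; ring,
    gegenbauer_cos (by positivity)]
  congr 2
  · push_cast
    ring
  · push_cast
    ring

/-- The factor `(2m + N - 2)/(N - 2)` of `Z_m` cancels `1/(2m + N - 2)`, leaving the threshold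
series divided by `N - 2`. -/
theorem hasSum_thresholdEquation (p : ℕ) {k : ℕ} (hk : k ≠ 0) {σ : ℝ} (h0 : 0 < σ) (h1 : σ < 1) :
    HasSum (fun m : ℕ => 1 / (2 * (m : ℝ) + (p + 3 : ℕ) - 2) *
        (2 * (σ ^ 2) ^ ((2 * (m : ℝ) + (p + 3 : ℕ) - 2) / 2) /
          (1 + (σ ^ 2) ^ ((2 * (m : ℝ) + (p + 3 : ℕ) - 2) / 2))) *
        ((harmonicDim (p + 3) m : ℝ) +
          ∑ j ∈ Ico 1 k, zonalHarmonic m (peak (p + 3) k 1 1) (peak (p + 3) k (j + 1) 1)))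
      (thresholdSeries (p + 1) k σ / (((p + 3 : ℕ) : ℝ) - 2)) := by
  have h := (summable_thresholdSeries (n := p + 1) (by omega) hk h0.le h1).hasSum.div_const
    ((p + 1 : ℕ) : ℝ)
  refine h.congr_of_eq (fun m => ?_) ?_
  · have hq : 2 * (m : ℝ) + (p + 3 : ℕ) - 2 = ((2 * m + (p + 1) : ℕ) : ℝ) := by
      push_cast
      ring
    have hpow : (σ ^ 2) ^ (((2 * m + (p + 1) : ℕ) : ℝ) / 2) = σ ^ (2 * m + (p + 1)) := by
      rw [← Real.rpow_natCast σ 2, ← Real.rpow_mul h0.le, ← Real.rpow_natCast σ (2 * m + (p + 1))]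
      congr 1
      push_cast
      ring
    have hsum : (harmonicDim (p + 3) m : ℝ) +
        ∑ j ∈ Ico 1 k, zonalHarmonic m (peak (p + 3) k 1 1) (peak (p + 3) k (j + 1) 1) =
        (2 * m + (p + 1 : ℕ)) / (p + 1 : ℕ) * orbitCoeff (((p + 1 : ℕ) : ℝ) / 2) k m := by
      simp only [zonalHarmonic_peak]
      rw [harmonicDim_eq, ← Finset.mul_sum, ← mul_add, orbitCoeff,
        Finset.sum_range_eq_add_Ico _ (Nat.pos_of_ne_zero hk)]
      simp
    have hq0 : (2 * (m : ℝ) + (p + 1 : ℕ)) ≠ 0 := by positivity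
    have hd : 1 + σ ^ (2 * m + (p + 1)) ≠ 0 := by positivity
    rw [hsum, hq, hpow]
    push_cast at hq0 ⊢
    field_simp
  · rw [thresholdSeries]
    congr 1
    push_cast
    ring

/-! ### The main theorem -/

theorem mainTheorem5 (N : ℕ) (hN : 3 ≤ N) :
    ∃ ρ : ℕ → ℝ,
      (∀ k : ℕ, 2 ≤ k →
        -- the minimum of `Λ₁` over `(s, 1)` is attained, for every inner radius `s`
        (∀ s ∈ Set.Ioo (0 : ℝ) 1,
          IsLeast (Lambda1 N k s '' Set.Ioo s 1) (minLambda1 N k s)) ∧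
        -- `ρ k` is the unique threshold
        IsThreshold N k (ρ k) ∧ (∀ s : ℝ, IsThreshold N k s → s = ρ k) ∧
        -- it is the unique zero of the minimum
        (∀ s ∈ Set.Ioo (0 : ℝ) 1, minLambda1 N k s = 0 ↔ s = ρ k) ∧
        -- the equation that determines it
        HasSum
          (fun m : ℕ =>
            1 / (2 * (m : ℝ) + N - 2) *
              (2 * ρ k ^ ((2 * (m : ℝ) + N - 2) / 2) /
                (1 + ρ k ^ ((2 * (m : ℝ) + N - 2) / 2))) *
              ((harmonicDim N m : ℝ) +
                ∑ j ∈ Finset.Ico 1 k, zonalHarmonic m (peak N k 1 1) (peak N k (j + 1) 1)))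
          (peakConst N k / ((N : ℝ) - 2)) ∧
        -- the explicit lower bound
        0 < thresholdParam N k ∧ thresholdBound N k < ρ k) ∧
      Filter.Tendsto (fun k : ℕ => peakConst N k / k) Filter.atTop Filter.atTop ∧
      Filter.Tendsto (fun k : ℕ => thresholdParam N k) Filter.atTop Filter.atTop ∧
      Filter.Tendsto (fun k : ℕ => thresholdBound N k) Filter.atTop (nhds 1) ∧
      Filter.Tendsto ρ Filter.atTop (nhds 1) ∧
      -- on a fixed annulus the minimum of `Λ₁` is negative for all large `k`
      (∀ s ∈ Set.Ioo (0 : ℝ) 1, ∀ᶠ k : ℕ in Filter.atTop, minLambda1 N k s < 0) ∧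
      -- monotonicity in `k`, and the closed form in dimension four
      StrictMonoOn (fun k : ℕ => peakConst N k) (Set.Ici 2) ∧
      (N = 4 →
        (∀ k : ℕ, 2 ≤ k → peakConst N k = ((k : ℝ) ^ 2 - 1) / 12) ∧
        StrictMonoOn (fun k : ℕ => peakConst N k / k) (Set.Ici 2)) := by
  obtain ⟨p, rfl⟩ : ∃ p, N = p + 3 := ⟨N - 3, by omega⟩
  have hn : p + 1 ≠ 0 := by omega
  have hex : ∀ k : ℕ, ∃ σ : ℝ, 2 ≤ k →
      σ ∈ Set.Ioo (0 : ℝ) 1 ∧ thresholdSeries (p + 1) k σ = peakConst (p + 3) k := by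
    intro k
    by_cases hk : 2 ≤ k
    · obtain ⟨σ, h1, h2⟩ := exists_thresholdSeries_eq (n := p + 1) (k := k) hn (by omega)
        (peakConst_pos (p + 1) hk)
      exact ⟨σ, fun _ => ⟨h1, h2⟩⟩
    -- For `k < 2` the value is arbitrary: all claims concern `k ≥ 2` or large `k`.
    · exact ⟨0, fun h => absurd h hk⟩
  choose σ hσ using hex
  have hmain : ∀ k : ℕ, 2 ≤ k → σ k ^ 2 ∈ Set.Ioo (0 : ℝ) 1 ∧
      (∀ s ∈ Set.Ioo (σ k ^ 2) 1, 0 < minLambda1 (p + 3) k s) ∧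
      (∀ s ∈ Set.Ioo 0 (σ k ^ 2), minLambda1 (p + 3) k s < 0) ∧
      minLambda1 (p + 3) k (σ k ^ 2) = 0 ∧ thresholdBound (p + 3) k < σ k ^ 2 := by
    intro k hk
    obtain ⟨⟨h0, h1⟩, he⟩ := hσ k hk
    have hk0 : k ≠ 0 := by omega
    have hmono := strictMonoOn_thresholdSeries (n := p + 1) hn hk0
    have hlt1 : σ k ^ 2 < 1 := by nlinarith
    refine ⟨⟨by positivity, hlt1⟩, fun s hs => ?_, fun s hs => ?_,
      (minLambda1_sign (n := p + 1) hn hk0 h0 h1).2.2 he, thresholdBound_lt_sq p hk h0 h1 he⟩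
    · have hs0 : 0 < s := lt_of_le_of_lt (sq_nonneg _) hs.1
      have h3 : √s < 1 := (Real.sqrt_lt' one_pos).2 (by simpa using hs.2)
      have h4 := hmono ⟨h0.le, h1⟩ ⟨Real.sqrt_nonneg s, h3⟩ (Real.lt_sqrt_of_sq_lt hs.1)
      rw [he] at h4
      have h5 := (minLambda1_sign (n := p + 1) hn hk0 (Real.sqrt_pos.2 hs0) h3).1 h4
      rwa [Real.sq_sqrt hs0.le] at h5
    · have h3 : √s < σ k := (Real.sqrt_lt' h0).2 hs.2
      have h4 := hmono ⟨Real.sqrt_nonneg s, h3.trans h1⟩ ⟨h0.le, h1⟩ h3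
      rw [he] at h4
      have h5 := (minLambda1_sign (n := p + 1) hn hk0 (Real.sqrt_pos.2 hs.1) (h3.trans h1)).2.1 h4
      rwa [Real.sq_sqrt hs.1.le] at h5
  have hlim : Tendsto (fun k => σ k ^ 2) atTop (𝓝 1) := by
    refine tendsto_of_tendsto_of_tendsto_of_le_of_le' (tendsto_thresholdBound p)
      tendsto_const_nhds ?_ ?_
    · filter_upwards [eventually_ge_atTop 2] with k hk
      exact (hmain k hk).2.2.2.2.le
    · filter_upwards [eventually_ge_atTop 2] with k hk
      exact (hmain k hk).1.2.le
  refine ⟨fun k => σ k ^ 2, fun k hk => ?_, tendsto_peakConst_div hn, tendsto_thresholdParam p,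
    tendsto_thresholdBound p, hlim, fun s hs => ?_, strictMonoOn_peakConst hn, fun h => ?_⟩
  · obtain ⟨hmem, hpos, hneg, hzero, hbound⟩ := hmain k hk
    obtain ⟨⟨h0, h1⟩, he⟩ := hσ k hk
    have hk0 : k ≠ 0 := by omega
    refine ⟨fun s hs => ?_, ⟨hmem, hpos, hneg⟩, fun s hs => ?_, fun s hs => ⟨fun h => ?_, ?_⟩, ?_,
      thresholdParam_pos p hk, hbound⟩
    · obtain ⟨-, -, -, h⟩ := exists_isLeast_Lambda1 (n := p + 1) hn hk0 hs.1 hs.2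
      exact h
    · obtain ⟨hs0, hs1, hs2⟩ := hs
      -- Between two distinct thresholds the minimum would be both positive and negative.
      rcases lt_trichotomy s (σ k ^ 2) with h | h | h
      · obtain ⟨t, ht⟩ := exists_between h
        exact absurd (hs1 t ⟨ht.1, ht.2.trans hmem.2⟩) (hneg t ⟨hs0.1.trans ht.1, ht.2⟩).not_gt
      · exact h
      · obtain ⟨t, ht⟩ := exists_between h
        exact absurd (hs2 t ⟨hmem.1.trans ht.1, ht.2⟩) (hpos t ⟨ht.1, ht.2.trans hs0.2⟩).not_gt
    · rcases lt_trichotomy s (σ k ^ 2) with h' | h' | h'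
      · exact absurd h (hneg s ⟨hs.1, h'⟩).ne
      · exact h'
      · exact absurd h (hpos s ⟨h', hs.2⟩).ne'
    · rintro rfl
      exact hzero
    · rw [← he]
      exact hasSum_thresholdEquation p hk0 h0 h1
  · filter_upwards [hlim.eventually (lt_mem_nhds hs.2), eventually_ge_atTop 2] with k hk hk2
    exact (hmain k hk2).2.2.1 s ⟨hs.1, hk⟩
  · obtain rfl : p = 1 := by omega
    exact ⟨fun k hk => peakConst_four hk, strictMonoOn_peakConst_four_div⟩
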